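/- Let $k,\ell\ge 0$ be integers and $r,s\in\{0,1,2,\dots,\infty,\omega\}$ with $r\ge 1$. **Solenoids.** A function $f(x,y)$ on an open subset of $\mathbb R^k\times\mathbb R^\ell$ is of class $C^{r,s}$ if all its mixed partial derivatives of total order $\le r$ and of order $\le s$ in $y$ exist and are continuous (and, if $r=\omega$, it is also analytic in $x$; if $r=s=\omega$, it is jointly analytic). Let $W$ be a foliated manifold of class $C^{r,s}$: a Hausdorff second countable space with an atlas of charts in $\mathbb R^k\times\mathbb R^\ell$ whose transition maps are locally of the form $(x,y)\mapsto (X(x,y),Y(y))$ with $X$ of class $C^{r,s}$ and $Y$ of class $C^s$. Let $S\subset W$ be a $k$-solenoid, i.e. a compact subset that is a union of leaves, and let $g$ be a Riemannian structure on it, i.e. a Riemannian metric of class $C^{r-1,s}$ on the leaves of $W$, with induced $k$-volume $\operatorname{Vol}_k$ on leaves. A *flow-box* $(U,\varphi)$ of $S$ is the restriction to $U=\hat U\cap S$ of a chart $\hat\varphi$ on $\hat U\subset W$ compatible with the foliated atlas, with $\varphi(U)=D^k\times K(U)$, where $D^k$ is the open unit ball of $\mathbb R^k$ and $K(U)\subset\mathbb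 R^\ell$; as usual it is assumed that $\hat\varphi|_U$ extends to a compatible chart whose domain contains $\overline U$ and which maps $\overline U$ onto $\overline D{}^k\times\overline{K(U)}$, with $\overline{K(U)}$ compact. The set $T=\varphi^{-1}(\{0\}\times K(U))$ is then called a *local transversal*. A *holonomy map* between local transversals $T_1,T_2$ is a homeomorphism $h:V\to h(V)$ from an open subset $V\subset T_1$ onto an open subset of $T_2$ whose germ at each $p\in V$ is obtained by lifting a path in a leaf from $p$ to $h(p)$ to the nearby leaves. **Transversal measures.** A transversal measure on $S$ is a family $(\mu_T)$ of locally finite Borel measures, one on each local transversal $T$, not all zero, such that $h_*(\mu_{T_1}|_V)=\mu_{T_2}|_{h(V)}$ for every holonomy map $h:V\subset T_1\to T_2$. The space of transversal measures carries the topology of weak convergence in each local transversal (the coarsest topology for which $(\mu_T)\mapsto\int f\,d\mu_T$ is continuous for all $T$ and all continuous compactly supported $f:T\to\mathbb R$), and $\overline{\mathcal M}_{\mathcal T}(S)$ is its quotient by multiplication by positive scalars, with the quotient topology. **Daval measures.** A Borel measure $\mu$ on $S$ is a daval measure if for every flow-box $(U,\varphi)$, with local transversal $T=\varphi^{-1}(\{0\}\times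 K(U))$, there is a Borel measure $\mu_{U,T}$ on $T$ such that $\mu(A)=\int_T\operatorname{Vol}_k(A_t)\,d\mu_{U,T}(t)$ for every Borel set $A\subset U$, where $A_t$ is the intersection of $A$ with the plaque of $U$ through $t$. Let $\mathcal M_{\mathcal L}(S)$ be the space of probability daval measures on $S$, with the weak-$*$ topology. **Theorem.** There is a one-to-one correspondence $(\mu_T)\leftrightarrow\mu$ between the transversal measures on $S$ and the non-zero finite daval measures on $S$, determined by $$\mu(A)=\int_T\operatorname{Vol}_k(A_t)\,d\mu_T(t)$$ for every flow-box $U$ with local transversal $T$ and every Borel set $A\subset U$. Furthermore, $[(\mu_T)]\mapsto \mu/\mu(S)$ is a well-defined homeomorphism $$\overline{\mathcal M}_{\mathcal T}(S)\;\cong\;\mathcal M_{\mathcal L}(S).$$ -/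

import Mathlib

open Set Filter Topology MeasureTheory
open scoped ContDiff NNReal ENNReal unitInterval

noncomputable section

namespace Solenoid

/-- The local model `ℝᵏ × ℝˡ` of a foliated manifold: the first factor is the leaf direction, the
second one the transverse direction. -/
abbrev Model (k l : ℕ) : Type :=
  EuclideanSpace ℝ (Fin k) × EuclideanSpace ℝ (Fin l)

/-! ### Foliated manifolds -/

section Regularity

variable {k l : ℕ} {G : Type*} [NormedAddCommGroup G] [NormedSpace ℝ G]

/-- The class `C^{r,s}` on an open set `Ω ⊆ ℝᵏ × ℝˡ`, where `r` and `s` are integers, `∞` or `ω`: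
all the mixed partial derivatives of total order at most `r` and of order at most `s` in the
transverse variable `y` exist and are continuous. If `r = ω` we ask moreover for analyticity in the
leaf variable `x`, and if `r = s = ω` for joint analyticity. -/
structure IsClass (r s : WithTop ℕ∞) (f : Model k l → G) (Ω : Set (Model k l)) : Prop where
  leaf : ∀ p ∈ Ω, ContDiffAt ℝ r (fun x => f (x, p.2)) p.1
  mixed : ∀ a b : ℕ, ((a + b : ℕ) : WithTop ℕ∞) ≤ r → (b : WithTop ℕ∞) ≤ s →
    ContDiffOn ℝ b (fun p : Model k l => iteratedFDeriv ℝ a (fun x => f (x, p.2)) p.1) Ω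
  analytic : r = ω → s = ω → ContDiffOn ℝ ω f Ω

/-- `f` is locally of the form `f(x,y) = (X(x,y), Y(y))` on the open set `Ω`, with `Y` of class
`C^s` and `X` of class `C^{r,s}`. -/
def IsFoliatedMap (r s : WithTop ℕ∞) (f : Model k l → Model k l) (Ω : Set (Model k l)) : Prop :=
  ∀ p ∈ Ω, ∃ N : Set (Model k l), IsOpen N ∧ p ∈ N ∧ N ⊆ Ω ∧
    IsClass r s (fun q => (f q).1) N ∧
    ∃ Y : EuclideanSpace ℝ (Fin l) → EuclideanSpace ℝ (Fin l),
      ContDiffOn ℝ s Y (Prod.snd '' N) ∧ ∀ q ∈ N, (f q).2 = Y q.2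

end Regularity

section Foliated

variable (k l : ℕ) (r s : WithTop ℕ∞) (W : Type*) [TopologicalSpace W] [ChartedSpace (Model k l) W]

/-- The changes of charts of the atlas of `W` are foliated maps of class `C^{r,s}`. -/
def IsFoliatedManifold : Prop :=
  ∀ e ∈ atlas (Model k l) W, ∀ e' ∈ atlas (Model k l) W,
    IsFoliatedMap r s (e.symm.trans e') (e.symm.trans e').source

variable {W}

/-- A flow-box for the foliated manifold `W`: a chart that can be added to the foliated atlas. -/
def IsFlowBoxOfManifold (φ : OpenPartialHomeomorph W (Model k l)) : Prop :=
  ∀ e ∈ atlas (Model k l) W,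
    IsFoliatedMap r s (φ.symm.trans e) (φ.symm.trans e).source ∧
    IsFoliatedMap r s (e.symm.trans φ) (e.symm.trans φ).source

/-- A path contained in a leaf: a continuous path whose transverse coordinate in every chart
of the foliated atlas is locally constant. -/
def IsLeafPath (γ : unitInterval → W) : Prop :=
  Continuous γ ∧ ∀ e ∈ atlas (Model k l) W, ∀ t, γ t ∈ e.source →
    ∀ᶠ t' in 𝓝 t, (e (γ t')).2 = (e (γ t)).2

/-- The leaf through `x`. -/
def leaf (x : W) : Set W :=
  {z | ∃ γ : unitInterval → W, IsLeafPath k l γ ∧ γ 0 = x ∧ γ 1 = z}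

/-- `S ⊆ W` is a `k`-solenoid (with structure defined by `W`): it is compact and it is a union of
leaves of `W`. -/
structure IsSolenoid (S : Set W) : Prop where
  isCompact : IsCompact S
  leaf_subset : ∀ x ∈ S, leaf k l x ⊆ S

/-- A flow-box for the solenoid `S`: a flow-box `chart` for `W` which maps `U = chart.source ∩ S`
onto `Dᵏ × K`, where `Dᵏ` is the open unit ball. Moreover the closure of `U` is contained in a
bigger flow-box, in which it becomes the product of the closed ball and the compact set `closure K`. -/
structure FlowBox (S : Set W) where
  chart : OpenPartialHomeomorph W (Model k l)
  isFlowBox : IsFlowBoxOfManifold k l r s chart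
  K : Set (EuclideanSpace ℝ (Fin l))
  image_eq : chart '' (chart.source ∩ S) = Metric.ball 0 1 ×ˢ K
  good : ∃ ψ : OpenPartialHomeomorph W (Model k l), IsFlowBoxOfManifold k l r s ψ ∧
    closure (chart.source ∩ S) ⊆ ψ.source ∧ EqOn ψ chart (chart.source ∩ S) ∧
    IsCompact (closure K) ∧
    ψ '' closure (chart.source ∩ S) = Metric.closedBall 0 1 ×ˢ closure K

variable {k l r s}

/-- The local transversal `φ⁻¹({0} × K)` of a flow-box. -/
def FlowBox.transversal {S : Set W} (B : FlowBox k l r s S) : Set W :=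
  B.chart.symm '' ({0} ×ˢ B.K)

/-- The open subset `U` of `S` on which the flow-box is defined. -/
def FlowBox.domain {S : Set W} (B : FlowBox k l r s S) : Set S :=
  Subtype.val ⁻¹' B.chart.source

variable (k l r s)

/-- The local transversals of the solenoid `S`. -/
def LocalTransversal (S : Set W) : Type _ :=
  {T : Set W // ∃ B : FlowBox k l r s S, B.transversal = T}

variable {k l r s} in
/-- The local transversal of a flow-box, as an element of the type of all local transversals. -/
def FlowBox.localTransversal {S : Set W} (B : FlowBox k l r s S) :
    LocalTransversal k l r s S :=
  ⟨B.transversal, B, rfl⟩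

/-- A holonomy map `h : V ⊆ T₁ → T₂`: a homeomorphism from an open subset `V` of `T₁` onto an open
subset of `T₂`, whose germ at each `p ∈ V` is obtained by lifting a path contained in a
leaf, from `p` to `h p`, to the nearby leaves. -/
def IsHolonomy {T₁ T₂ : Set W} (h : OpenPartialHomeomorph T₁ T₂) : Prop :=
  ∀ p ∈ h.source, ∃ V ∈ 𝓝 p, V ⊆ h.source ∧ ∃ Γ : T₁ × unitInterval → W,
    ContinuousOn Γ (V ×ˢ univ) ∧
    ∀ q ∈ V, IsLeafPath k l (fun t => Γ (q, t)) ∧ Γ (q, 0) = (q : W) ∧ Γ (q, 1) = (h q : W)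

end Foliated

/-! ### Transversal measures -/

section TransversalMeasure

variable (k l : ℕ) (r s : WithTop ℕ∞) {W : Type*} [TopologicalSpace W] [MeasurableSpace W]
  [ChartedSpace (Model k l) W]

/-- A transversal measure: a family of locally finite measures, one on each local transversal,
invariant by holonomy and not all zero. -/
@[ext]
structure TransversalMeasure (S : Set W) where
  measure : (T : LocalTransversal k l r s S) → Measure T.1
  locallyFinite : ∀ T, IsLocallyFiniteMeasure (measure T)
  invariant : ∀ (T₁ T₂ : LocalTransversal k l r s S) (h : OpenPartialHomeomorph T₁.1 T₂.1),
    IsHolonomy k l h →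
      ((measure T₁).restrict h.source).map h = (measure T₂).restrict h.target
  nontrivial : ∃ T, measure T ≠ 0

variable {k l r s}

/-- The topology generated by weak convergence in each local transversal: the coarsest one for
which the integrals of the continuous functions with compact support on the local transversals
are continuous. -/
instance (S : Set W) : TopologicalSpace (TransversalMeasure k l r s S) :=
  ⨅ (T : LocalTransversal k l r s S) (f : CompactlySupportedContinuousMap T.1 ℝ),
    TopologicalSpace.induced (fun τ => ∫ t, f t ∂(τ.measure T)) inferInstance

variable (k l r s)

/-- Two transversal measures are equivalent if they differ by a positive scalar. -/
def scalarSetoid (S : Set W) : Setoid (TransversalMeasure k l r s S) where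
  r τ τ' := ∃ c : ℝ≥0, 0 < c ∧ ∀ T, τ'.measure T = c • τ.measure T
  iseqv :=
    { refl := fun τ => ⟨1, one_pos, fun T => (one_smul _ _).symm⟩
      symm := by
        rintro τ τ' ⟨c, hc, h⟩
        exact ⟨c⁻¹, inv_pos.2 hc, fun T => by rw [h T, smul_smul, inv_mul_cancel₀ hc.ne', one_smul]⟩
      trans := by
        rintro τ₁ τ₂ τ₃ ⟨c, hc, h⟩ ⟨d, hd, h'⟩
        exact ⟨d * c, mul_pos hd hc, fun T => by rw [h' T, h T, smul_smul]⟩ }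

/-- The space of transversal measures modulo positive scalar multiplication, with the quotient
topology. -/
abbrev ProjTransversalMeasure (S : Set W) : Type _ := Quotient (scalarSetoid k l r s S)

end TransversalMeasure

/-! ### Leafwise Riemannian metrics and daval measures -/

section Riemannian

variable (k l : ℕ) (r s : WithTop ℕ∞) (W : Type*) [TopologicalSpace W] [ChartedSpace (Model k l) W]

/-- A Riemannian metric of class `C^{r-1,s}` on the leaves of `W`: its expression `toFun φ (x, y)`
in each flow-box `φ` of `W` is an inner product on the tangent space `ℝᵏ` of `ℝᵏ × {y}`
at `x`, and these expressions are related by the changes of coordinates. The condition `q + 1 ≤ r`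
on the order `q` stands for `q ≤ r - 1`. -/
structure LeafMetric where
  toFun : OpenPartialHomeomorph W (Model k l) → Model k l →
    (EuclideanSpace ℝ (Fin k) →L[ℝ] EuclideanSpace ℝ (Fin k) →L[ℝ] ℝ)
  symm : ∀ φ, IsFlowBoxOfManifold k l r s φ → ∀ p ∈ φ.target, ∀ v w,
    toFun φ p v w = toFun φ p w v
  pos : ∀ φ, IsFlowBoxOfManifold k l r s φ → ∀ p ∈ φ.target, ∀ v, v ≠ 0 → 0 < toFun φ p v v
  isClass : ∀ φ, IsFlowBoxOfManifold k l r s φ → ∀ q : WithTop ℕ∞, q + 1 ≤ r →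
    IsClass q s (toFun φ) φ.target
  compatible : ∀ φ ψ, IsFlowBoxOfManifold k l r s φ → IsFlowBoxOfManifold k l r s ψ →
    ∀ p ∈ (φ.symm.trans ψ).source, ∀ v w,
      toFun φ p v w = toFun ψ ((φ.symm.trans ψ) p)
        (fderiv ℝ (fun x => ((φ.symm.trans ψ) (x, p.2)).1) p.1 v)
        (fderiv ℝ (fun x => ((φ.symm.trans ψ) (x, p.2)).1) p.1 w)

variable {k l r s W}

/-- The density `√det (g_ij)` of the Riemannian volume of the leaves in the flow-box `φ`. -/
def LeafMetric.density (g : LeafMetric k l r s W) (φ : OpenPartialHomeomorph W (Model k l))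
    (p : Model k l) : ℝ :=
  Real.sqrt (Matrix.det (Matrix.of fun i j : Fin k =>
    g.toFun φ p (EuclideanSpace.single i 1) (EuclideanSpace.single j 1)))

/-- The Riemannian `k`-volume of `A_y = A ∩ φ⁻¹(Dᵏ × {y})`, where `A` is a subset of the domain of
the flow-box. -/
def FlowBox.sliceVolume {S : Set W} (B : FlowBox k l r s S) (g : LeafMetric k l r s W)
    (A : Set S) (y : EuclideanSpace ℝ (Fin l)) : ℝ≥0∞ :=
  ∫⁻ x in {x | x ∈ Metric.ball 0 1 ∧ B.chart.symm (x, y) ∈ (Subtype.val '' A : Set W)},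
    ENNReal.ofReal (g.density B.chart (x, y))

variable [MeasurableSpace W]

/-- In the flow-box `B` with local transversal `T`, the measure `μ` disintegrates as the volume
along leaves with respect to the measure `ν` on `T`: `μ(A) = ∫_T Vol_k(A_y) dν(y)` for all Borel
sets `A ⊆ U`. -/
def FlowBox.Disintegrates {S : Set W} (B : FlowBox k l r s S) (g : LeafMetric k l r s W)
    (μ : Measure S) (ν : Measure B.transversal) : Prop :=
  ∀ A : Set S, MeasurableSet A → A ⊆ B.domain →
    μ A = ∫⁻ t : B.transversal, B.sliceVolume g A (B.chart t).2 ∂ν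

/-- A daval measure: it disintegrates as volume along leaves in every flow-box. -/
def IsDaval {S : Set W} (g : LeafMetric k l r s W) (μ : Measure S) : Prop :=
  ∀ B : FlowBox k l r s S, ∃ ν : Measure B.transversal, B.Disintegrates g μ ν

end Riemannian

end Solenoid

end

set_option linter.unusedSectionVars false

/-! In a flow-box the leafwise volume is a positive continuous density `rho` times Lebesgue measure
on the disk. A measure ν on the local transversal therefore gives a measure on the box by
integrating plaque volumes (`boxMeasure`). Conversely, ν is recovered by integrating 1/`rho` over
disk × E: the plaque integrals of this function are the Lebesgue volume of the disk over E and 0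
elsewhere (`Disintegrates.volume_mul`, `Disintegrates.unique`). What remains is compatibility
between boxes.

The local computation is `exists_overlap`. Near a common point two flow-boxes differ by a map (x, y)
↦ (X(x, y), Y(y)). The factor Y induces a holonomy map h between open subsets of the transversals.
The densities differ by |det ∂X/∂x| (`LeafMetric.density_eq`), so by change of variables h preserves
plaque integrals.

For a transversal measure, invariance under these h makes the box measures agree on intersections
(`boxMeasure_eq`); they are glued along a countable cover, and compactness of S gives finiteness.
For a finite daval measure, uniqueness of the disintegration shows that each h transports the
measure of one box to that of the other (`Overlap.transports`). A general holonomy map follows a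
leaf path through several boxes; connectedness of the interval reduces it to overlaps and to slides
inside one box (`SlidesTo.change`, `SlidesTo.slide`, `transports_of_isHolonomy`).

For the topologies, a partition of unity turns ∫ f dμ into a finite sum of integrals of compactly
supported continuous functions on transversals. Conversely, for f ≥ 0 on a transversal, multiplying
by a bump on the disk and dividing by `rho` writes its integral as a constant times the μ-integral
of a continuous function. So normalization is continuous, and its inverse lifts continuously to
transversal measures before passing to the quotient. -/

noncomputable section

namespace Solenoid

/-! ### Stability of the class C^{r,s} and of foliated maps -/

section Regularity

variable {k l : ℕ} {r s : WithTop ℕ∞} {G G' : Type*} [NormedAddCommGroup G] [NormedSpace ℝ G]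
  [NormedAddCommGroup G'] [NormedSpace ℝ G']

lemma IsClass.mono {f : Model k l → G} {Ω Ω' : Set (Model k l)} (h : IsClass r s f Ω)
    (hΩ : Ω' ⊆ Ω) : IsClass r s f Ω' where
  leaf p hp := h.leaf p (hΩ hp)
  mixed a b hab hb := (h.mixed a b hab hb).mono hΩ
  analytic hr hs := (h.analytic hr hs).mono hΩ

/-- The class `C^{r,s}` is stable under affine changes of the leaf variable. -/
lemma IsClass.comp_affine {f : Model k l → G} {Ω Ω' : Set (Model k l)} (h : IsClass r s f Ω)
    (x₀ : EuclideanSpace ℝ (Fin k)) (A : EuclideanSpace ℝ (Fin k) ≃L[ℝ] EuclideanSpace ℝ (Fin k))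
    (hΩ : ∀ q ∈ Ω', (x₀ + A q.1, q.2) ∈ Ω) :
    IsClass r s (fun q : Model k l => f (x₀ + A q.1, q.2)) Ω' := by
  have hsm : ∀ n : WithTop ℕ∞, ContDiff ℝ n (fun q : Model k l => ((x₀ + A q.1, q.2) : Model k l)) :=
    fun n => (contDiff_const.add (A.contDiff.comp contDiff_fst)).prodMk contDiff_snd
  refine ⟨fun p hp => ?_, fun a b hab hb => ?_, fun hr hs => ?_⟩
  · change ContDiffAt ℝ r ((fun x => f (x, p.2)) ∘ fun x => x₀ + A x) p.1
    exact (h.leaf _ (hΩ p hp)).comp p.1 (contDiff_const.add A.contDiff).contDiffAt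
  -- Pulling back by A is a fixed continuous linear operator on multilinear maps, so the regularity
  -- of the mixed derivative in p passes through it.
  · have key : ∀ p : Model k l, iteratedFDeriv ℝ a (fun x => f (x₀ + A x, p.2)) p.1 =
        ContinuousMultilinearMap.compContinuousLinearMapL (𝕜 := ℝ) (F := G)
          (fun _ : Fin a => (A : EuclideanSpace ℝ (Fin k) →L[ℝ] EuclideanSpace ℝ (Fin k)))
          (iteratedFDeriv ℝ a (fun x => f (x, p.2)) (x₀ + A p.1)) := by
      intro p
      have h1 := A.iteratedFDerivWithin_comp_right (fun x => f (x₀ + x, p.2))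
        (s := univ) uniqueDiffOn_univ (x := p.1) (mem_univ _) a
      simp only [preimage_univ, iteratedFDerivWithin_univ] at h1
      have h2 := iteratedFDeriv_comp_add_left (𝕜 := ℝ) (f := fun x => f (x, p.2)) a x₀ (x := A p.1)
      rw [← h2]
      exact h1
    refine ContDiffOn.congr ?_ (fun p _ => key p)
    refine (ContinuousLinearMap.contDiff _).comp_contDiffOn ?_
    exact (h.mixed a b hab hb).comp (hsm b).contDiffOn hΩ
  · exact (h.analytic hr hs).comp (hsm ω).contDiffOn hΩ

/-- The class `C^{r,s}` is stable under affine changes of the values. -/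
lemma IsClass.affine_comp {f : Model k l → G} {Ω : Set (Model k l)} (h : IsClass r s f Ω)
    (L : G ≃L[ℝ] G') (c : G') : IsClass r s (fun q => L (f q) + c) Ω := by
  refine ⟨fun p hp => ?_, fun a b hab hb => ?_, fun hr hs => ?_⟩
  · exact (L.contDiff.contDiffAt.comp p.1 (h.leaf p hp)).add contDiffAt_const
  · have key : ∀ p ∈ Ω, iteratedFDeriv ℝ a (fun x => L (f (x, p.2)) + c) p.1 =
        ContinuousLinearMap.compContinuousMultilinearMapL ℝ
          (fun _ : Fin a => EuclideanSpace ℝ (Fin k)) G G' (L : G →L[ℝ] G')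
          (iteratedFDeriv ℝ a (fun x => f (x, p.2)) p.1) +
          iteratedFDeriv ℝ a (fun _ => c) (0 : EuclideanSpace ℝ (Fin k)) := by
      intro p hp
      have ha : (a : WithTop ℕ∞) ≤ r := le_trans (by exact_mod_cast Nat.le_add_right a b) hab
      have h0 : ContDiffAt ℝ a (fun x => L (f (x, p.2))) p.1 :=
        (L.contDiff.contDiffAt.comp p.1 ((h.leaf p hp).of_le ha))
      have h1 := iteratedFDeriv_add_apply (i := a) h0 (contDiffAt_const (c := c))
      have h2 : iteratedFDeriv ℝ a (fun x => L (f (x, p.2))) p.1 = _ :=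
        L.iteratedFDeriv_comp_left (f := fun x => f (x, p.2)) (x := p.1) (i := a)
      -- The derivative of a constant is the same at every point; evaluating it at 0 makes this term
      -- visibly independent of p.
      have h3 : iteratedFDeriv ℝ a (fun _ => c) p.1 =
          iteratedFDeriv ℝ a (fun _ => c) (0 : EuclideanSpace ℝ (Fin k)) := by
        rcases Nat.eq_zero_or_pos a with rfl | ha
        · ext; simp
        · simp [iteratedFDeriv_const_of_ne ha.ne']
      rw [h2, h3] at h1
      exact h1
    refine ContDiffOn.congr ?_ key
    exact ((ContinuousLinearMap.contDiff _).comp_contDiffOn (h.mixed a b hab hb)).add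
      contDiffOn_const
  · exact (L.contDiff.comp_contDiffOn (h.analytic hr hs)).add contDiffOn_const

lemma IsFoliatedMap.mono {f : Model k l → Model k l} {Ω Ω' : Set (Model k l)}
    (h : IsFoliatedMap r s f Ω) (hΩ' : IsOpen Ω') (hΩ : Ω' ⊆ Ω) : IsFoliatedMap r s f Ω' := by
  intro p hp
  obtain ⟨N, hN, hpN, -, hc, Y, hY, hfY⟩ := h p (hΩ hp)
  exact ⟨N ∩ Ω', hN.inter hΩ', ⟨hpN, hp⟩, inter_subset_right, hc.mono inter_subset_left, Y,
    hY.mono (image_mono inter_subset_left), fun q hq => hfY q hq.1⟩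

/-- The affine change of the leaf variable `(x, y) ↦ (A⁻¹ (x - x₀), y)` of the local model. -/
def affineModel (x₀ : EuclideanSpace ℝ (Fin k))
    (A : EuclideanSpace ℝ (Fin k) ≃L[ℝ] EuclideanSpace ℝ (Fin k)) : Model k l ≃ₜ Model k l where
  toFun q := (A.symm q.1 + -(A.symm x₀), q.2)
  invFun q := (x₀ + A q.1, q.2)
  left_inv q := by ext1 <;> simp
  right_inv q := by ext1 <;> simp
  continuous_toFun := by fun_prop
  continuous_invFun := by fun_prop

lemma IsFoliatedMap.comp_affineModel_symm {f : Model k l → Model k l} {Ω : Set (Model k l)}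
    (h : IsFoliatedMap r s f Ω) (x₀ : EuclideanSpace ℝ (Fin k))
    (A : EuclideanSpace ℝ (Fin k) ≃L[ℝ] EuclideanSpace ℝ (Fin k)) :
    IsFoliatedMap r s (f ∘ (affineModel x₀ A).symm) ((affineModel (l := l) x₀ A).symm ⁻¹' Ω) := by
  intro p hp
  obtain ⟨N, hN, hpN, hNΩ, hc, Y, hY, hfY⟩ := h _ hp
  refine ⟨(affineModel x₀ A).symm ⁻¹' N, hN.preimage (affineModel x₀ A).symm.continuous, hpN,
    preimage_mono hNΩ, hc.comp_affine x₀ A (fun q hq => hq), Y, hY.mono ?_, fun q hq => hfY _ hq⟩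
  rintro _ ⟨q, hq, rfl⟩
  exact ⟨_, hq, rfl⟩

lemma IsFoliatedMap.affineModel_comp {f : Model k l → Model k l} {Ω : Set (Model k l)}
    (h : IsFoliatedMap r s f Ω) (x₀ : EuclideanSpace ℝ (Fin k))
    (A : EuclideanSpace ℝ (Fin k) ≃L[ℝ] EuclideanSpace ℝ (Fin k)) :
    IsFoliatedMap r s (affineModel x₀ A ∘ f) Ω := by
  intro p hp
  obtain ⟨N, hN, hpN, hNΩ, hc, Y, hY, hfY⟩ := h _ hp
  exact ⟨N, hN, hpN, hNΩ, hc.affine_comp A.symm _, Y, hY, fun q hq => hfY _ hq⟩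

/-- This weak form of the regularity of a transition map suffices for holonomy and for the change of
variables formula. Differentiability along the leaves is where `1 ≤ r` enters. -/
lemma IsFoliatedMap.exists_product {f : Model k l → Model k l} {Ω : Set (Model k l)}
    (h : IsFoliatedMap r s f Ω) (hr : 1 ≤ r) {p : Model k l} (hp : p ∈ Ω) :
    ∃ N : Set (Model k l), IsOpen N ∧ p ∈ N ∧ N ⊆ Ω ∧
      ∃ Y : EuclideanSpace ℝ (Fin l) → EuclideanSpace ℝ (Fin l),
        ContinuousOn Y (Prod.snd '' N) ∧ ∀ q ∈ N, (f q).2 = Y q.2 ∧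
          DifferentiableAt ℝ (fun x => (f (x, q.2)).1) q.1 := by
  obtain ⟨N, hN, hpN, hNΩ, hc, Y, hY, hfY⟩ := h _ hp
  exact ⟨N, hN, hpN, hNΩ, Y, hY.continuousOn, fun q hq => ⟨hfY q hq,
    (hc.leaf q hq).differentiableAt (by rintro rfl; simp at hr)⟩⟩

end Regularity

/-! ### Changes of coordinates between flow-boxes, and leaf paths -/

section Charts

variable {k l : ℕ} {r s : WithTop ℕ∞} {W : Type*} [TopologicalSpace W] [ChartedSpace (Model k l) W]
  {φ ψ : OpenPartialHomeomorph W (Model k l)}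

lemma IsFlowBoxOfManifold.restr (h : IsFlowBoxOfManifold k l r s φ) (O : Set W) :
    IsFlowBoxOfManifold k l r s (φ.restr O) := by
  refine fun e he => ⟨(h e he).1.mono (OpenPartialHomeomorph.open_source _) ?_,
    (h e he).2.mono (OpenPartialHomeomorph.open_source _) ?_⟩
  · intro q hq
    simp only [mfld_simps] at hq ⊢
    exact ⟨hq.1.1, hq.2⟩
  · intro q hq
    simp only [mfld_simps] at hq ⊢
    exact ⟨hq.1, hq.2.1⟩

lemma IsFlowBoxOfManifold.transHomeomorph (h : IsFlowBoxOfManifold k l r s φ)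
    (x₀ : EuclideanSpace ℝ (Fin k))
    (A : EuclideanSpace ℝ (Fin k) ≃L[ℝ] EuclideanSpace ℝ (Fin k)) :
    IsFlowBoxOfManifold k l r s (φ.transHomeomorph (affineModel x₀ A)) :=
  fun e he => ⟨(h e he).1.comp_affineModel_symm x₀ A, (h e he).2.affineModel_comp x₀ A⟩

lemma IsFoliatedManifold.isFlowBoxOfManifold (hW : IsFoliatedManifold k l r s W)
    (hφ : φ ∈ atlas (Model k l) W) : IsFlowBoxOfManifold k l r s φ :=
  fun e he => ⟨hW φ hφ e he, hW e he φ hφ⟩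

/-- The change of coordinates between two flow-boxes of `W` is locally of the form
`(x, y) ↦ (X (x, y), Y y)`. -/
lemma IsFlowBoxOfManifold.exists_product (hφ : IsFlowBoxOfManifold k l r s φ)
    (hψ : IsFlowBoxOfManifold k l r s ψ) (hr : 1 ≤ r) {p : Model k l}
    (hp : p ∈ (φ.symm.trans ψ).source) :
    ∃ N : Set (Model k l), IsOpen N ∧ p ∈ N ∧ N ⊆ (φ.symm.trans ψ).source ∧
      ∃ Y : EuclideanSpace ℝ (Fin l) → EuclideanSpace ℝ (Fin l),
        ContinuousOn Y (Prod.snd '' N) ∧ ∀ q ∈ N, (ψ (φ.symm q)).2 = Y q.2 ∧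
          DifferentiableAt ℝ (fun x => (ψ (φ.symm (x, q.2))).1) q.1 := by
  -- Compatibility is assumed only with charts of the atlas, so the transition is factored through
  -- one of them.
  set e := chartAt (Model k l) (φ.symm p)
  have he : e ∈ atlas (Model k l) W := chart_mem_atlas _ _
  have hpe : φ.symm p ∈ e.source := mem_chart_source _ _
  have hp' := hp
  simp only [mfld_simps] at hp'
  have hp1 : p ∈ (φ.symm.trans e).source := by simp only [mfld_simps]; exact ⟨hp'.1, hpe⟩
  have hp2 : e (φ.symm p) ∈ (e.symm.trans ψ).source := by
    simp only [mfld_simps]; exact ⟨e.map_source hpe, by rw [e.left_inv hpe]; exact hp'.2⟩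
  obtain ⟨N₁, hN₁, hpN₁, hs₁, Y₁, hY₁, h₁⟩ := (hφ e he).1.exists_product hr hp1
  obtain ⟨N₂, hN₂, hpN₂, hs₂, Y₂, hY₂, h₂⟩ := (hψ e he).2.exists_product hr hp2
  set N := N₁ ∩ ((φ.symm.trans e).source ∩ (φ.symm.trans e) ⁻¹' N₂) ∩ (φ.symm.trans ψ).source
  have hNo : IsOpen N := (hN₁.inter ((φ.symm.trans e).isOpen_inter_preimage hN₂)).inter
    (φ.symm.trans ψ).open_source
  have key : ∀ q ∈ N, ψ (φ.symm q) = ψ (e.symm (e (φ.symm q))) := by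
    intro q hq
    have := hq.1.2.1
    simp only [mfld_simps] at this
    rw [e.left_inv this.2]
  have hN2 : ∀ q ∈ N, e (φ.symm q) ∈ N₂ := fun q hq => hq.1.2.2
  have hN1 : ∀ q ∈ N, (e (φ.symm q)).2 = Y₁ q.2 := fun q hq => (h₁ q hq.1.1).1
  refine ⟨N, hNo, ⟨⟨hpN₁, hp1, hpN₂⟩, hp⟩, inter_subset_right, Y₂ ∘ Y₁, ?_, ?_⟩
  · refine hY₂.comp (hY₁.mono (image_mono fun q hq => hq.1.1)) ?_
    rintro _ ⟨q, hq, rfl⟩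
    exact ⟨_, hN2 q hq, hN1 q hq⟩
  · intro q hq
    refine ⟨?_, ?_⟩
    · rw [key q hq, Function.comp, ← hN1 q hq]
      exact (h₂ _ (hN2 q hq)).1
    · have hev : ∀ᶠ x in 𝓝 q.1, (x, q.2) ∈ N :=
        (Continuous.prodMk_left q.2).continuousAt.eventually_mem (hNo.mem_nhds hq)
      have hd2 := (h₂ _ (hN2 q hq)).2
      have hd1 := (h₁ q hq.1.1).2
      rw [hN1 q hq] at hd2
      refine (DifferentiableAt.comp q.1 hd2 hd1).congr_of_eventuallyEq ?_
      filter_upwards [hev] with x hx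
      rw [key _ hx]
      simp only [Function.comp]
      congr 2
      exact congrArg e.symm (Prod.ext rfl (hN1 _ hx))

/-- Near a given point, the change of coordinates between two flow-boxes of `W` is a product
of which the transverse factor is a local homeomorphism. -/
lemma IsFlowBoxOfManifold.exists_transition (hφ : IsFlowBoxOfManifold k l r s φ)
    (hψ : IsFlowBoxOfManifold k l r s ψ) (hr : 1 ≤ r) {p : Model k l}
    (hp : p ∈ (φ.symm.trans ψ).source) {N : Set (Model k l)} (hN : N ∈ 𝓝 p) :
    ∃ δ > 0, ∃ Y : OpenPartialHomeomorph (EuclideanSpace ℝ (Fin l)) (EuclideanSpace ℝ (Fin l)),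
      p.2 ∈ Y.source ∧ ∀ x ∈ Metric.ball p.1 δ, ∀ y ∈ Y.source,
        (x, y) ∈ N ∧ (x, y) ∈ (φ.symm.trans ψ).source ∧ (ψ (φ.symm (x, y))).2 = Y y ∧
          DifferentiableAt ℝ (fun x => (ψ (φ.symm (x, y))).1) x := by
  obtain ⟨N₁, hN₁, hpN₁, hs₁, Y, hY, h₁⟩ := hφ.exists_product hψ hr hp
  have hp2 : (φ.symm.trans ψ) p ∈ (ψ.symm.trans φ).source := (φ.symm.trans ψ).map_source hp
  obtain ⟨N₂, hN₂, hpN₂, hs₂, Y', hY', h₂⟩ := hψ.exists_product hφ hr hp2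
  -- The transition and its inverse must be products simultaneously, so that Y' inverts Y.
  have hM : N ∩ N₁ ∩ ((φ.symm.trans ψ).source ∩ (φ.symm.trans ψ) ⁻¹' N₂) ∈ 𝓝 p :=
    inter_mem (inter_mem hN (hN₁.mem_nhds hpN₁))
      (((φ.symm.trans ψ).isOpen_inter_preimage hN₂).mem_nhds ⟨hp, hpN₂⟩)
  obtain ⟨δ, hδ, hball⟩ := Metric.mem_nhds_iff.1 hM
  rw [← ball_prod_same] at hball
  have hb : ∀ x ∈ Metric.ball p.1 δ, ∀ y ∈ Metric.ball p.2 δ, (x, y) ∈ _ :=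
    fun x hx y hy => hball ⟨hx, hy⟩
  have hp0 : p.1 ∈ Metric.ball p.1 δ := Metric.mem_ball_self hδ
  have hYY : ∀ x ∈ Metric.ball p.1 δ, ∀ y ∈ Metric.ball p.2 δ, (ψ (φ.symm (x, y))).2 = Y y :=
    fun x hx y hy => (h₁ _ (hb x hx y hy).1.2).1
  have hinv : ∀ y ∈ Metric.ball p.2 δ, Y' (Y y) = y := by
    intro y hy
    have h3 := hb _ hp0 y hy
    have h4 := (h₂ _ h3.2.2).1
    have h5 := (φ.symm.trans ψ).left_inv h3.2.1
    have h6 : φ (ψ.symm ((φ.symm.trans ψ) (p.1, y))) = (p.1, y) := h5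
    rw [h6] at h4
    rw [← hYY _ hp0 y hy]
    exact h4.symm
  -- Openness of the image of Y follows because the transition map and the projection are open maps;
  -- no inverse function theorem is needed.
  have himg : Y '' Metric.ball p.2 δ =
      Prod.snd '' ((φ.symm.trans ψ) '' (Metric.ball p.1 δ ×ˢ Metric.ball p.2 δ)) := by
    ext z
    constructor
    · rintro ⟨y, hy, rfl⟩
      exact ⟨_, ⟨(p.1, y), ⟨hp0, hy⟩, rfl⟩, hYY _ hp0 y hy⟩
    · rintro ⟨_, ⟨⟨x, y⟩, ⟨hx, hy⟩, rfl⟩, rfl⟩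
      exact ⟨y, hy, (hYY x hx y hy).symm⟩
  refine ⟨δ, hδ, {
    toFun := Y
    invFun := Y'
    source := Metric.ball p.2 δ
    target := Y '' Metric.ball p.2 δ
    map_source' := fun y hy => mem_image_of_mem _ hy
    map_target' := by rintro _ ⟨y, hy, rfl⟩; rw [hinv y hy]; exact hy
    left_inv' := fun y hy => hinv y hy
    right_inv' := by rintro _ ⟨y, hy, rfl⟩; rw [hinv y hy]
    open_source := Metric.isOpen_ball
    open_target := by
      rw [himg]
      refine isOpenMap_snd _ ?_
      exact (φ.symm.trans ψ).isOpen_image_of_subset_source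
        (Metric.isOpen_ball.prod Metric.isOpen_ball) (fun q hq => (hball hq).2.1)
    continuousOn_toFun := hY.mono fun y hy => ⟨(p.1, y), (hb _ hp0 y hy).1.2, rfl⟩
    continuousOn_invFun := hY'.mono (by
      rintro _ ⟨y, hy, rfl⟩
      exact ⟨_, (hb _ hp0 y hy).2.2, hYY _ hp0 y hy⟩) }, Metric.mem_ball_self hδ, ?_⟩
  intro x hx y hy
  exact ⟨(hb x hx y hy).1.1, (hb x hx y hy).2.1, hYY x hx y hy, (h₁ _ (hb x hx y hy).1.2).2⟩

/-- In every flow-box, the transverse coordinate of a path contained in a leaf is locally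
constant. -/
lemma IsLeafPath.eventually_eq {γ : unitInterval → W} (hγ : IsLeafPath k l γ)
    (hW : IsFoliatedManifold k l r s W) (hφ : IsFlowBoxOfManifold k l r s φ) (hr : 1 ≤ r)
    {t : unitInterval} (ht : γ t ∈ φ.source) : ∀ᶠ t' in 𝓝 t, (φ (γ t')).2 = (φ (γ t)).2 := by
  set e := chartAt (Model k l) (γ t)
  have he : e ∈ atlas (Model k l) W := chart_mem_atlas _ _
  have hte : γ t ∈ e.source := mem_chart_source _ _
  have hp : e (γ t) ∈ (e.symm.trans φ).source := by
    simp only [mfld_simps]; exact ⟨e.map_source hte, by rwa [e.left_inv hte]⟩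
  obtain ⟨N, hN, hpN, hs, Y, -, h⟩ := (hW.isFlowBoxOfManifold he).exists_product hφ hr hp
  have h1 : ∀ᶠ t' in 𝓝 t, γ t' ∈ e.source :=
    hγ.1.continuousAt.eventually_mem (e.open_source.mem_nhds hte)
  have h2 : ∀ᶠ t' in 𝓝 t, e (γ t') ∈ N :=
    ((e.continuousAt hte).comp hγ.1.continuousAt).eventually_mem (hN.mem_nhds hpN)
  filter_upwards [h1, h2, hγ.2 e he t hte] with t' h1 h2 h3
  have h4 := (h _ h2).1
  have h5 := (h _ hpN).1
  rw [e.left_inv h1] at h4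
  rw [e.left_inv hte] at h5
  rw [h4, h5, h3]

/-- A path in a plaque of a flow-box is contained in a leaf. -/
lemma IsFlowBoxOfManifold.isLeafPath (hφ : IsFlowBoxOfManifold k l r s φ) (hr : 1 ≤ r)
    {c : unitInterval → EuclideanSpace ℝ (Fin k)} (hc : Continuous c)
    {y : EuclideanSpace ℝ (Fin l)} (hy : ∀ t, (c t, y) ∈ φ.target) :
    IsLeafPath k l (fun t => φ.symm (c t, y)) := by
  have hcont : Continuous fun t => ((c t, y) : Model k l) := by fun_prop
  refine ⟨φ.continuousOn_symm.comp_continuous hcont hy, fun e he t ht => ?_⟩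
  obtain ⟨N, hN, hpN, hs, Y, -, h⟩ := (hφ e he).1.exists_product hr (p := (c t, y)) (by
    simp only [mfld_simps]; exact ⟨hy t, ht⟩)
  filter_upwards [hcont.continuousAt.eventually_mem (hN.mem_nhds hpN)] with t' ht'
  exact (h _ ht').1.trans (h _ hpN).1.symm

/-- The concatenation at time `1/2` of two paths contained in leaves. -/
lemma IsLeafPath.ite {γ₁ γ₂ : unitInterval → W} (h₁ : IsLeafPath k l γ₁) (h₂ : IsLeafPath k l γ₂)
    (h : ∀ t : unitInterval, (t : ℝ) = 1 / 2 → γ₁ t = γ₂ t) :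
    IsLeafPath k l (fun t => if (t : ℝ) ≤ 1 / 2 then γ₁ t else γ₂ t) := by
  refine ⟨Continuous.if_le h₁.1 h₂.1 continuous_subtype_val continuous_const h, ?_⟩
  intro e he t ht
  beta_reduce at ht ⊢
  rcases lt_trichotomy (t : ℝ) (1 / 2) with hlt | heq | hgt
  · rw [if_pos hlt.le] at ht ⊢
    filter_upwards [h₁.2 e he t ht, continuous_subtype_val.continuousAt.eventually_lt_const hlt]
      with t' h1 h2
    rw [if_pos h2.le, h1]
  · rw [if_pos heq.le] at ht ⊢
    filter_upwards [h₁.2 e he t ht, h₂.2 e he t (h t heq ▸ ht)] with t' h1 h2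
    split_ifs
    · exact h1
    · rw [h2, h t heq]
  · rw [if_neg hgt.not_ge] at ht ⊢
    filter_upwards [h₂.2 e he t ht, continuous_subtype_val.continuousAt.eventually_const_lt hgt]
      with t' h1 h2
    rw [if_neg h2.not_ge, h1]

end Charts

/-- The open unit ball of `ℝᵏ`, as a type. -/
abbrev Disk (k : ℕ) : Type := Metric.ball (0 : EuclideanSpace ℝ (Fin k)) 1

/-! ### Existence of flow-boxes and their product parametrization -/

section FlowBoxes

variable {k l : ℕ} {r s : WithTop ℕ∞} {W : Type*} [TopologicalSpace W] [ChartedSpace (Model k l) W]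
  {S : Set W}

/-- Flow-boxes exist around each point of a solenoid. -/
lemma IsSolenoid.exists_flowBox [T2Space W] (hS : IsSolenoid k l S)
    (hW : IsFoliatedManifold k l r s W) (hr : 1 ≤ r) (p : S) :
    ∃ B : FlowBox k l r s S, p ∈ B.domain := by
  set e := chartAt (Model k l) (p : W)
  have he : IsFlowBoxOfManifold k l r s e := hW.isFlowBoxOfManifold (chart_mem_atlas _ _)
  have hpe : (p : W) ∈ e.source := mem_chart_source _ _
  obtain ⟨ε, hε, hball⟩ := Metric.nhds_basis_closedBall.mem_iff.1
    (e.open_target.mem_nhds (e.map_source hpe))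
  -- Scaling by ε and translating by x₀ makes the leaf factor the unit ball required in a flow-box.
  set A : EuclideanSpace ℝ (Fin k) ≃L[ℝ] EuclideanSpace ℝ (Fin k) :=
    ContinuousLinearEquiv.smulLeft (Units.mk0 ε hε.ne') with hA
  have hAx : ∀ x, A x = ε • x := fun x => rfl
  set x₀ := (e p).1
  set y₀ := (e p).2
  have hsub : ∀ x ∈ Metric.closedBall (0 : EuclideanSpace ℝ (Fin k)) 1,
      ∀ y ∈ Metric.closedBall y₀ ε, (x₀ + A x, y) ∈ e.target := by
    intro x hx y hy
    apply hball
    rw [← Prod.mk.eta (p := e p), ← closedBall_prod_same]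
    refine ⟨?_, hy⟩
    rw [mem_closedBall_zero_iff] at hx
    rw [hAx, mem_closedBall_iff_norm, add_sub_cancel_left, norm_smul, Real.norm_of_nonneg hε.le]
    nlinarith
  set ψ := e.transHomeomorph (affineModel x₀ A)
  have hψ : IsFlowBoxOfManifold k l r s ψ := he.transHomeomorph x₀ A
  have hψt : ∀ x ∈ Metric.closedBall (0 : EuclideanSpace ℝ (Fin k)) 1,
      ∀ y ∈ Metric.closedBall y₀ ε, (x, y) ∈ ψ.target := hsub
  have hψp : ψ p = (0, y₀) := by
    refine Prod.ext ?_ rfl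
    change A.symm (e p).1 + -(A.symm x₀) = 0
    simp [x₀]
  set Q : Set (Model k l) := Metric.ball 0 1 ×ˢ Metric.ball y₀ ε
  have hQ : IsOpen Q := Metric.isOpen_ball.prod Metric.isOpen_ball
  -- Membership in S is tested at the centre of the plaque; `hleaf` transfers it to the other
  -- points. The unrestricted ψ will serve as the larger chart containing the closure.
  set K : Set (EuclideanSpace ℝ (Fin l)) := {y | y ∈ Metric.ball y₀ ε ∧ ψ.symm (0, y) ∈ S}
  set φ := ψ.restr (ψ.source ∩ ψ ⁻¹' Q)
  have hφs : φ.source = ψ.source ∩ ψ ⁻¹' Q := by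
    rw [OpenPartialHomeomorph.restr_source' _ _ (ψ.isOpen_inter_preimage hQ)]
    exact inter_eq_right.2 inter_subset_left
  -- A straight segment in a plaque is a leaf path, and S contains the leaf of each of its points.
  have hleaf : ∀ x ∈ Metric.ball (0 : EuclideanSpace ℝ (Fin k)) 1,
      ∀ x' ∈ Metric.ball (0 : EuclideanSpace ℝ (Fin k)) 1, ∀ y ∈ Metric.ball y₀ ε,
      ψ.symm (x, y) ∈ S → ψ.symm (x', y) ∈ S := by
    intro x hx x' hx' y hy hS'
    refine hS.leaf_subset _ hS' ⟨fun t => ψ.symm (AffineMap.lineMap x x' (t : ℝ), y),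
      hψ.isLeafPath hr (by fun_prop) fun t => ?_, by simp, by simp⟩
    exact hψt _ (Metric.ball_subset_closedBall
      ((convex_ball _ _).lineMap_mem hx hx' t.2)) _ (Metric.ball_subset_closedBall hy)
  have himage : φ '' (φ.source ∩ S) = Metric.ball 0 1 ×ˢ K := by
    ext ⟨x, y⟩
    constructor
    · rintro ⟨q, ⟨hq, hqS⟩, hqx⟩
      rw [hφs] at hq
      have hqx' : ψ q = (x, y) := hqx
      have hxy : (x, y) ∈ Q := hqx' ▸ hq.2
      refine ⟨hxy.1, hxy.2, hleaf x hxy.1 0 (Metric.mem_ball_self one_pos) y hxy.2 ?_⟩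
      rwa [← hqx', ψ.left_inv hq.1]
    · rintro ⟨hx, hy, hyS⟩
      have ht := hψt x (Metric.ball_subset_closedBall hx) y (Metric.ball_subset_closedBall hy)
      refine ⟨ψ.symm (x, y), ⟨?_, hleaf 0 (Metric.mem_ball_self one_pos) x hx y hy hyS⟩,
        ψ.right_inv ht⟩
      rw [hφs]
      exact ⟨ψ.map_target ht, by rw [mem_preimage, ψ.right_inv ht]; exact ⟨hx, hy⟩⟩
  have hKsub : closure K ⊆ Metric.closedBall y₀ ε :=
    closure_minimal (fun y hy => Metric.ball_subset_closedBall hy.1) Metric.isClosed_closedBall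
  have hKc : IsCompact (closure K) := (isCompact_closedBall y₀ ε).of_isClosed_subset
    isClosed_closure hKsub
  have hU : φ.source ∩ S = ψ.symm '' (Metric.ball 0 1 ×ˢ K) := by
    rw [← himage, ← image_comp]
    refine ((image_congr fun q hq => ?_).trans (image_id _)).symm
    rw [hφs] at hq
    exact ψ.left_inv hq.1.1
  have hprod : closure (Metric.ball (0 : EuclideanSpace ℝ (Fin k)) 1 ×ˢ K) =
      Metric.closedBall 0 1 ×ˢ closure K := by
    rw [closure_prod_eq, closure_ball _ one_ne_zero]
  have hclos_t : Metric.closedBall (0 : EuclideanSpace ℝ (Fin k)) 1 ×ˢ closure K ⊆ ψ.target :=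
    fun q hq => hψt q.1 hq.1 q.2 (hKsub hq.2)
  -- The right-hand side is a compact image, hence closed in the Hausdorff space W; continuity of
  -- `ψ.symm` gives the other inclusion.
  have hclos : closure (φ.source ∩ S) = ψ.symm '' (Metric.closedBall 0 1 ×ˢ closure K) := by
    apply subset_antisymm
    · refine closure_minimal ?_ ?_
      · rw [hU]
        exact image_mono (prod_mono Metric.ball_subset_closedBall subset_closure)
      · exact (((isCompact_closedBall _ _).prod hKc).image_of_continuousOn
          (ψ.continuousOn_symm.mono hclos_t)).isClosed
    · rw [hU, ← hprod]
      exact (ψ.continuousOn_symm.mono (hprod ▸ hclos_t)).image_closure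
  refine ⟨⟨φ, hψ.restr _, K, himage, ψ, hψ, ?_, fun q _ => rfl, hKc, ?_⟩, ?_⟩
  · rw [hclos]
    rintro _ ⟨q, hq, rfl⟩
    exact ψ.map_target (hclos_t hq)
  · rw [hclos, ← image_comp]
    exact (image_congr fun q hq => ψ.right_inv (hclos_t hq)).trans (image_id _)
  · change (p : W) ∈ φ.source
    rw [hφs]
    refine ⟨hpe, ?_⟩
    rw [mem_preimage, hψp]
    exact ⟨Metric.mem_ball_self one_pos, Metric.mem_ball_self hε⟩

namespace FlowBox

variable (B : FlowBox k l r s S)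

/-- The transverse coordinate in a flow-box. -/
def height (q : W) : EuclideanSpace ℝ (Fin l) := (B.chart q).2

lemma mem_domain {q : S} : q ∈ B.domain ↔ (q : W) ∈ B.chart.source := Iff.rfl

lemma chart_mem {q : W} (hq : q ∈ B.chart.source) (hS : q ∈ S) :
    (B.chart q).1 ∈ Metric.ball (0 : EuclideanSpace ℝ (Fin k)) 1 ∧ B.height q ∈ B.K := by
  have : B.chart q ∈ Metric.ball (0 : EuclideanSpace ℝ (Fin k)) 1 ×ˢ B.K :=
    B.image_eq ▸ mem_image_of_mem _ ⟨hq, hS⟩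
  exact this

lemma mem_target {x : EuclideanSpace ℝ (Fin k)} (hx : x ∈ Metric.ball 0 1)
    {y : EuclideanSpace ℝ (Fin l)} (hy : y ∈ B.K) : (x, y) ∈ B.chart.target := by
  have : (x, y) ∈ B.chart '' (B.chart.source ∩ S) := B.image_eq.symm ▸ ⟨hx, hy⟩
  obtain ⟨q, hq, h⟩ := this
  exact h ▸ B.chart.map_source hq.1

lemma symm_mem {x : EuclideanSpace ℝ (Fin k)} (hx : x ∈ Metric.ball 0 1)
    {y : EuclideanSpace ℝ (Fin l)} (hy : y ∈ B.K) : B.chart.symm (x, y) ∈ S := by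
  have : (x, y) ∈ B.chart '' (B.chart.source ∩ S) := B.image_eq.symm ▸ ⟨hx, hy⟩
  obtain ⟨q, hq, h⟩ := this
  rw [← h, B.chart.left_inv hq.1]
  exact hq.2

lemma isOpen_domain : IsOpen B.domain := B.chart.open_source.preimage continuous_subtype_val

lemma zero_mem_ball : (0 : EuclideanSpace ℝ (Fin k)) ∈ Metric.ball 0 1 :=
  Metric.mem_ball_self one_pos

lemma transversal_spec (t : B.transversal) : (t : W) ∈ B.chart.source ∧ (t : W) ∈ S ∧
    (B.chart t).1 = 0 ∧ B.height t ∈ B.K := by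
  obtain ⟨_, ⟨x, y⟩, ⟨hx, hy⟩, rfl⟩ := t
  obtain rfl : x = 0 := hx
  have ht := B.mem_target zero_mem_ball hy
  exact ⟨B.chart.map_target ht, B.symm_mem zero_mem_ball hy, by rw [B.chart.right_inv ht],
    by rw [height, B.chart.right_inv ht]; exact hy⟩

/-- The point of the local transversal with a given transverse coordinate. -/
def point (y : EuclideanSpace ℝ (Fin l)) (hy : y ∈ B.K) : B.transversal :=
  ⟨B.chart.symm (0, y), (0, y), ⟨rfl, hy⟩, rfl⟩

lemma height_mem (t : B.transversal) : B.height t ∈ B.K := (B.transversal_spec t).2.2.2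

lemma height_point {y : EuclideanSpace ℝ (Fin l)} (hy : y ∈ B.K) : B.height (B.point y hy) = y := by
  simp only [height, point, B.chart.right_inv (B.mem_target zero_mem_ball hy)]

lemma symm_zero_height (t : B.transversal) : B.chart.symm (0, B.height t) = t := by
  obtain ⟨h1, -, h2, -⟩ := B.transversal_spec t
  rw [height, ← h2, Prod.mk.eta, B.chart.left_inv h1]

lemma height_injective : Function.Injective (fun t : B.transversal => B.height t) := by
  intro t t' h
  ext
  rw [← B.symm_zero_height t, ← B.symm_zero_height t']
  exact congrArg (fun y => B.chart.symm (0, y)) h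

lemma continuousOn_height : ContinuousOn B.height B.chart.source :=
  continuous_snd.comp_continuousOn B.chart.continuousOn

lemma continuous_height : Continuous (fun t : B.transversal => B.height t) :=
  B.continuousOn_height.comp_continuous continuous_subtype_val fun t => (B.transversal_spec t).1

lemma continuous_point : Continuous (fun y : B.K => B.point y y.2) := by
  refine Continuous.subtype_mk ?_ _
  exact B.chart.continuousOn_symm.comp_continuous (by fun_prop)
    fun y => B.mem_target zero_mem_ball y.2

/-- The transverse coordinate identifies the local transversal with `K`. -/
def heightHomeo : B.transversal ≃ₜ B.K where
  toFun t := ⟨B.height t, B.height_mem t⟩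
  invFun y := B.point y y.2
  left_inv t := B.height_injective (by simp only [height_point])
  right_inv y := Subtype.ext (B.height_point y.2)
  continuous_toFun := B.continuous_height.subtype_mk _
  continuous_invFun := B.continuous_point

lemma isInducing_height : IsInducing (fun t : B.transversal => B.height t) :=
  IsInducing.subtypeVal.comp B.heightHomeo.isInducing

/-- The parametrization of a flow-box of a solenoid by the product of the open unit ball and the
local transversal. -/
def homeo : Disk k × B.transversal ≃ₜ B.domain where
  toFun z := ⟨⟨B.chart.symm (z.1, B.height z.2), B.symm_mem z.1.2 (B.height_mem z.2)⟩,
    B.mem_domain.2 (B.chart.map_target (B.mem_target z.1.2 (B.height_mem z.2)))⟩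
  invFun q := (⟨(B.chart q.1).1, (B.chart_mem (B.mem_domain.1 q.2) q.1.2).1⟩,
    B.point (B.height q.1) (B.chart_mem (B.mem_domain.1 q.2) q.1.2).2)
  left_inv := by
    rintro ⟨x, t⟩
    have := B.chart.right_inv (B.mem_target x.2 (B.height_mem t))
    refine Prod.ext (Subtype.ext ?_) (B.height_injective ?_)
    · simp [this]
    · simp only [height_point]
      exact (congrArg Prod.snd this : _)
  right_inv := by
    rintro ⟨⟨q, hqS⟩, hq⟩
    refine Subtype.ext (Subtype.ext ?_)
    simp only [height_point]
    exact B.chart.left_inv (B.mem_domain.1 hq)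
  continuous_toFun := by
    refine Continuous.subtype_mk (Continuous.subtype_mk ?_ _) _
    refine B.chart.continuousOn_symm.comp_continuous ?_
      fun z => B.mem_target z.1.2 (B.height_mem z.2)
    exact (continuous_subtype_val.comp continuous_fst).prodMk
      (B.continuous_height.comp continuous_snd)
  continuous_invFun := by
    have h1 : Continuous fun q : B.domain => B.chart q.1 :=
      B.chart.continuousOn.comp_continuous (continuous_subtype_val.comp continuous_subtype_val)
        fun q => q.2
    refine Continuous.prodMk (Continuous.subtype_mk h1.fst _) ?_
    exact B.continuous_point.comp (Continuous.subtype_mk h1.snd fun q => (B.chart_mem (B.mem_domain.1 q.2) q.1.2).2)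

/-- The parametrization of a flow-box as a map to the solenoid. -/
def param (z : Disk k × B.transversal) : S := (B.homeo z).1

lemma isOpenEmbedding_param : IsOpenEmbedding B.param :=
  B.isOpen_domain.isOpenEmbedding_subtypeVal.comp B.homeo.isOpenEmbedding

lemma range_param : range B.param = B.domain := by
  change range (Subtype.val ∘ B.homeo) = _
  rw [range_comp, B.homeo.surjective.range_eq, image_univ, Subtype.range_coe]

lemma param_mem (z : Disk k × B.transversal) : B.param z ∈ B.domain := (B.homeo z).2

lemma chart_param (z : Disk k × B.transversal) :
    B.chart (B.param z) = ((z.1 : EuclideanSpace ℝ (Fin k)), B.height z.2) :=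
  B.chart.right_inv (B.mem_target z.1.2 (B.height_mem z.2))

lemma coe_param (z : Disk k × B.transversal) :
    (B.param z : W) = B.chart.symm (z.1, B.height z.2) := rfl

end FlowBox

end FlowBoxes

/-! ### The Riemannian density in coordinates -/

section Density

variable {k l : ℕ} {r s : WithTop ℕ∞} {W : Type*} [TopologicalSpace W] [ChartedSpace (Model k l) W]
  {φ ψ : OpenPartialHomeomorph W (Model k l)} (g : LeafMetric k l r s W)

/-- The Gram matrix of a Riemannian metric on the leaves. -/
def LeafMetric.gram (φ : OpenPartialHomeomorph W (Model k l)) (p : Model k l) :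
    Matrix (Fin k) (Fin k) ℝ :=
  Matrix.of fun i j : Fin k =>
    g.toFun φ p (EuclideanSpace.single i 1) (EuclideanSpace.single j 1)

variable {g}

lemma LeafMetric.toFun_apply (φ : OpenPartialHomeomorph W (Model k l)) (p : Model k l)
    (v w : EuclideanSpace ℝ (Fin k)) :
    g.toFun φ p v w = ∑ i, ∑ j, v i * w j * g.gram φ p i j := by
  have hv : ∀ v : EuclideanSpace ℝ (Fin k), v = ∑ i, v i • EuclideanSpace.single i (1 : ℝ) := by
    intro v
    ext j
    simp [Finset.sum_apply, Pi.single_apply]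
  conv_lhs => rw [hv v, hv w]
  simp only [map_sum, map_smul, _root_.sum_apply, _root_.smul_apply,
    smul_eq_mul, LeafMetric.gram, Matrix.of_apply, Finset.mul_sum]
  rw [Finset.sum_comm]
  exact Finset.sum_congr rfl fun i _ => Finset.sum_congr rfl fun j _ => by ring

lemma LeafMetric.det_gram_pos (hφ : IsFlowBoxOfManifold k l r s φ) {p : Model k l}
    (hp : p ∈ φ.target) : 0 < (g.gram φ p).det := by
  refine Matrix.PosDef.det_pos (Matrix.PosDef.of_dotProduct_mulVec_pos ?_ ?_)
  · ext i j
    simp only [Matrix.conjTranspose_apply, star_trivial]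
    exact g.symm φ hφ p hp _ _
  · intro x hx
    have h := g.pos φ hφ p hp (WithLp.toLp 2 x) (by simpa using hx)
    rw [LeafMetric.toFun_apply] at h
    refine h.trans_eq ?_
    simp only [dotProduct, Matrix.mulVec, star_trivial, Finset.mul_sum]
    exact Finset.sum_congr rfl fun i _ => Finset.sum_congr rfl fun j _ => by ring

lemma LeafMetric.density_pos (hφ : IsFlowBoxOfManifold k l r s φ) {p : Model k l}
    (hp : p ∈ φ.target) : 0 < g.density φ p :=
  Real.sqrt_pos.2 (LeafMetric.det_gram_pos hφ hp)

lemma LeafMetric.continuousOn_density (hr : 1 ≤ r) (hφ : IsFlowBoxOfManifold k l r s φ) :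
    ContinuousOn (g.density φ) φ.target := by
  -- `1 ≤ r` allows order 0 in `isClass`. The mixed derivative with a = b = 0 is the metric itself,
  -- as a 0-multilinear map, which gives joint continuity.
  have h0 : IsClass 0 s (g.toFun φ) φ.target := g.isClass φ hφ 0 (by simpa using hr)
  have h1 := (h0.mixed 0 0 (by simp) (by simp)).continuousOn
  have h2 : ContinuousOn (g.toFun φ) φ.target := by
    have := (ContinuousMultilinearMap.apply ℝ
      (fun _ : Fin 0 => EuclideanSpace ℝ (Fin k)) _ 0).continuous.comp_continuousOn h1
    refine this.congr fun p hp => ?_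
    simp
  refine Real.continuous_sqrt.comp_continuousOn ?_
  have h3 : Continuous fun G : EuclideanSpace ℝ (Fin k) →L[ℝ] EuclideanSpace ℝ (Fin k) →L[ℝ] ℝ =>
      Matrix.det (Matrix.of fun i j : Fin k =>
        G (EuclideanSpace.single i 1) (EuclideanSpace.single j 1)) := by
    refine Continuous.matrix_det (continuous_matrix fun i j => ?_)
    simp only [Matrix.of_apply]
    fun_prop
  exact h3.comp_continuousOn h2

/-- The Gram matrices satisfy G_φ = Jᵀ G_ψ J with J the leafwise Jacobian; take determinants and
square roots. This factor cancels the Jacobian of the change of variables. -/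
lemma LeafMetric.density_eq (hφ : IsFlowBoxOfManifold k l r s φ)
    (hψ : IsFlowBoxOfManifold k l r s ψ) {p : Model k l} (hp : p ∈ (φ.symm.trans ψ).source) :
    g.density φ p = |(fderiv ℝ (fun x => (ψ (φ.symm (x, p.2))).1) p.1).det| *
      g.density ψ (ψ (φ.symm p)) := by
  set L := fderiv ℝ (fun x => (ψ (φ.symm (x, p.2))).1) p.1 with hL
  set b := (EuclideanSpace.basisFun (Fin k) ℝ).toBasis
  set J := LinearMap.toMatrix b b (L : EuclideanSpace ℝ (Fin k) →ₗ[ℝ] EuclideanSpace ℝ (Fin k))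
    with hJ
  have hJL : ∀ i j, L (EuclideanSpace.single j 1) i = J i j := by
    intro i j
    rw [hJ, LinearMap.toMatrix_apply]
    simp [b]
  have hgram : g.gram φ p = J.transpose * g.gram ψ (ψ (φ.symm p)) * J := by
    ext i j
    have := g.compatible φ ψ hφ hψ p hp (EuclideanSpace.single i 1) (EuclideanSpace.single j 1)
    have h2 : g.gram φ p i j = g.toFun ψ (ψ (φ.symm p)) (L (EuclideanSpace.single i 1))
      (L (EuclideanSpace.single j 1)) := this
    rw [h2, LeafMetric.toFun_apply]
    simp only [hJL, Matrix.mul_apply, Matrix.transpose_apply, Finset.sum_mul]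
    rw [Finset.sum_comm]
    exact Finset.sum_congr rfl fun i _ => Finset.sum_congr rfl fun j _ => by ring
  have hdet : L.det = J.det := by
    rw [hJ, LinearMap.det_toMatrix]
  change Real.sqrt (g.gram φ p).det = _ * Real.sqrt (g.gram ψ _).det
  rw [hgram, Matrix.det_mul, Matrix.det_mul, Matrix.det_transpose, hdet,
    show J.det * (g.gram ψ (ψ (φ.symm p))).det * J.det =
      J.det ^ 2 * (g.gram ψ (ψ (φ.symm p))).det by ring, Real.sqrt_mul (sq_nonneg _),
    Real.sqrt_sq_eq_abs]

end Density

/-! ### Lebesgue measure on the open unit ball -/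

section Disk

variable {k : ℕ}

instance : MeasureSpace (Disk k) := Measure.Subtype.measureSpace

instance : IsFiniteMeasure (volume : Measure (Disk k)) := by
  refine ⟨?_⟩
  have h : (volume : Measure (Disk k)) univ = volume (Subtype.val '' (univ : Set (Disk k))) :=
    comap_subtype_coe_apply Metric.isOpen_ball.measurableSet volume univ
  rw [h, Subtype.coe_image_univ]
  exact measure_ball_lt_top

instance : (volume : Measure (Disk k)).IsOpenPosMeasure := by
  refine ⟨fun U hU hne => ?_⟩
  have h : (volume : Measure (Disk k)) U = volume (Subtype.val '' U) :=
    comap_subtype_coe_apply Metric.isOpen_ball.measurableSet volume U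
  rw [h]
  exact ((Metric.isOpen_ball.isOpenMap_subtype_val U hU).measure_pos volume
    (hne.image _)).ne'

lemma lintegral_disk (f : EuclideanSpace ℝ (Fin k) → ℝ≥0∞) :
    ∫⁻ x : Disk k, f x = ∫⁻ x in Metric.ball 0 1, f x :=
  lintegral_subtype_comap Metric.isOpen_ball.measurableSet f

end Disk

/-! ### Integration along plaques -/

section LeafIntegral

variable {k l : ℕ} {r s : WithTop ℕ∞} {W : Type*} [TopologicalSpace W]
  [ChartedSpace (Model k l) W] {S : Set W}

namespace FlowBox

variable (B : FlowBox k l r s S) (g : LeafMetric k l r s W)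

/-- The density of the Riemannian volume of the plaques, in the coordinates of a flow-box. -/
def rho (z : Disk k × B.transversal) : ℝ := g.density B.chart (z.1, B.height z.2)

lemma rho_pos (z : Disk k × B.transversal) : 0 < B.rho g z :=
  LeafMetric.density_pos B.isFlowBox (B.mem_target z.1.2 (B.height_mem z.2))

lemma continuous_rho (hr : 1 ≤ r) : Continuous (B.rho g) := by
  refine (LeafMetric.continuousOn_density hr B.isFlowBox).comp_continuous ?_
    fun z => B.mem_target z.1.2 (B.height_mem z.2)
  exact (continuous_subtype_val.comp continuous_fst).prodMk
    (B.continuous_height.comp continuous_snd)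

/-- The integral of a function on the plaque through a point of the local transversal. -/
def leafIntegral (f : S → ℝ≥0∞) (t : B.transversal) : ℝ≥0∞ :=
  ∫⁻ x : Disk k, f (B.param (x, t)) * ENNReal.ofReal (B.rho g (x, t))

/-- Extending f by zero from S to W moves the integral to ℝᵏ, where the change of variables formula
applies. -/
lemma leafIntegral_eq_setLIntegral (f : S → ℝ≥0∞) (t : B.transversal) :
    B.leafIntegral g f t = ∫⁻ x in Metric.ball 0 1,
      Function.extend Subtype.val f 0 (B.chart.symm (x, B.height t)) *
        ENNReal.ofReal (g.density B.chart (x, B.height t)) := by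
  rw [← lintegral_disk]
  refine lintegral_congr fun x => ?_
  rw [← B.coe_param (x, t), Subtype.val_injective.extend_apply]
  rfl

end FlowBox

end LeafIntegral

/-! ### Disintegration in a single flow-box -/

section Disintegration

variable {k l : ℕ} {r s : WithTop ℕ∞} {W : Type*} [TopologicalSpace W]
  [SecondCountableTopology W] [MeasurableSpace W] [BorelSpace W]
  [ChartedSpace (Model k l) W] {S : Set W}

namespace FlowBox

variable (B : FlowBox k l r s S) (g : LeafMetric k l r s W)

lemma measurable_param : Measurable B.param := B.isOpenEmbedding_param.continuous.measurable

lemma measurable_leafIntegral (hr : 1 ≤ r) {f : S → ℝ≥0∞} (hf : Measurable f) :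
    Measurable (B.leafIntegral g f) :=
  Measurable.lintegral_prod_left' ((hf.comp B.measurable_param).mul
    (B.continuous_rho g hr).measurable.ennreal_ofReal)

/-- Slice volumes become integrals of indicators, the form that extends to measurable functions. -/
lemma sliceVolume_eq {A : Set S} (hA : MeasurableSet A) (t : B.transversal) :
    B.sliceVolume g A (B.chart t).2 = B.leafIntegral g (A.indicator 1) t := by
  set a : Set (Disk k) := {x | B.param (x, t) ∈ A}
  have ha : MeasurableSet a := hA.preimage (B.measurable_param.comp measurable_prodMk_right)
  have hset : {x : EuclideanSpace ℝ (Fin k) | x ∈ Metric.ball 0 1 ∧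
      B.chart.symm (x, (B.chart t).2) ∈ (Subtype.val '' A : Set W)} = Subtype.val '' a := by
    ext x
    constructor
    · rintro ⟨hx, q, hq, hqx⟩
      refine ⟨⟨x, hx⟩, ?_, rfl⟩
      have : B.param (⟨x, hx⟩, t) = q := Subtype.ext hqx.symm
      simpa [a, this] using hq
    · rintro ⟨x, hx, rfl⟩
      exact ⟨x.2, _, hx, rfl⟩
  have ha' : MeasurableSet (Subtype.val '' a : Set (EuclideanSpace ℝ (Fin k))) :=
    MeasurableSet.subtype_image Metric.isOpen_ball.measurableSet ha
  have hsub : (Subtype.val '' a : Set (EuclideanSpace ℝ (Fin k))) ⊆ Metric.ball 0 1 := by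
    rintro _ ⟨x, -, rfl⟩
    exact x.2
  have hleaf : B.leafIntegral g (A.indicator 1) t = ∫⁻ x : Disk k,
      (Subtype.val '' a).indicator
        (fun x => ENNReal.ofReal (g.density B.chart (x, B.height t))) x := by
    refine lintegral_congr fun x => ?_
    by_cases hx : B.param (x, t) ∈ A
    · rw [indicator_of_mem hx, Pi.one_apply, one_mul,
        indicator_of_mem (show (x : EuclideanSpace ℝ (Fin k)) ∈ Subtype.val '' a from ⟨x, hx, rfl⟩)]
      rfl
    · rw [indicator_of_notMem hx, indicator_of_notMem, zero_mul]
      rintro ⟨x', hx', h⟩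
      exact hx (Subtype.ext h ▸ hx')
  rw [hleaf, sliceVolume, hset, lintegral_disk,
    ← lintegral_indicator Metric.isOpen_ball.measurableSet, indicator_indicator,
    inter_eq_right.2 hsub, lintegral_indicator ha']
  rfl

/-- The Riemannian volume of the plaques of a flow-box, as measures on the solenoid. -/
def plaqueMeasure (t : B.transversal) : Measure S :=
  ((volume : Measure (Disk k)).withDensity fun x => ENNReal.ofReal (B.rho g (x, t))).map
    fun x => B.param (x, t)

lemma lintegral_plaqueMeasure (hr : 1 ≤ r) {f : S → ℝ≥0∞} (hf : Measurable f) (t : B.transversal) :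
    ∫⁻ q, f q ∂(B.plaqueMeasure g t) = B.leafIntegral g f t := by
  have hp : Measurable fun x : Disk k => B.param (x, t) :=
    B.measurable_param.comp measurable_prodMk_right
  have hρ : Measurable fun x : Disk k => ENNReal.ofReal (B.rho g (x, t)) :=
    ((B.continuous_rho g hr).measurable.comp measurable_prodMk_right).ennreal_ofReal
  rw [plaqueMeasure, lintegral_map hf hp]
  exact (lintegral_withDensity_eq_lintegral_mul _ hρ (hf.comp hp)).trans
    (lintegral_congr fun x => mul_comm _ _)

lemma measurable_plaqueMeasure (hr : 1 ≤ r) : Measurable (B.plaqueMeasure g) := by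
  refine Measure.measurable_of_measurable_coe _ fun A hA => ?_
  have h1 : Measurable (A.indicator (1 : S → ℝ≥0∞)) := measurable_one.indicator hA
  convert B.measurable_leafIntegral g hr h1 using 1
  ext t
  rw [← B.lintegral_plaqueMeasure g hr h1, lintegral_indicator_one hA]

/-- The measure on a solenoid supported by a flow-box which is given by the volume along leaves
and a measure on the local transversal. -/
def boxMeasure (ν : Measure B.transversal) : Measure S := ν.bind (B.plaqueMeasure g)

lemma lintegral_boxMeasure (hr : 1 ≤ r) (ν : Measure B.transversal) {f : S → ℝ≥0∞}
    (hf : Measurable f) :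
    ∫⁻ q, f q ∂(B.boxMeasure g ν) = ∫⁻ t, B.leafIntegral g f t ∂ν := by
  rw [boxMeasure, Measure.lintegral_bind (B.measurable_plaqueMeasure g hr).aemeasurable
    hf.aemeasurable]
  exact lintegral_congr fun t => B.lintegral_plaqueMeasure g hr hf t

lemma boxMeasure_apply (hr : 1 ≤ r) (ν : Measure B.transversal) {A : Set S}
    (hA : MeasurableSet A) :
    B.boxMeasure g ν A = ∫⁻ t, B.leafIntegral g (A.indicator 1) t ∂ν := by
  rw [← B.lintegral_boxMeasure g hr ν (measurable_one.indicator hA), lintegral_indicator_one hA]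

variable {g}

lemma disintegrates_iff (hr : 1 ≤ r) {μ : Measure S} {ν : Measure B.transversal} :
    B.Disintegrates g μ ν ↔ ∀ A : Set S, MeasurableSet A → A ⊆ B.domain →
      μ A = B.boxMeasure g ν A := by
  refine forall_congr' fun A => forall_congr' fun hA => forall_congr' fun _ => ?_
  rw [B.boxMeasure_apply g hr ν hA]
  simp only [B.sliceVolume_eq g hA]

variable {B}

/-- Agreement on Borel subsets of the box is equality of two restricted measures, so it passes to
functions vanishing outside the box. -/
lemma Disintegrates.lintegral_eq (hr : 1 ≤ r) {μ : Measure S} {ν : Measure B.transversal}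
    (h : B.Disintegrates g μ ν) {f : S → ℝ≥0∞} (hf : Measurable f)
    (hfB : ∀ q, f q ≠ 0 → q ∈ B.domain) :
    ∫⁻ q, f q ∂μ = ∫⁻ t, B.leafIntegral g f t ∂ν := by
  have hres : μ.restrict B.domain = (B.boxMeasure g ν).restrict B.domain := by
    ext A hA
    rw [Measure.restrict_apply hA, Measure.restrict_apply hA]
    exact (B.disintegrates_iff hr).1 h _ (hA.inter B.isOpen_domain.measurableSet) inter_subset_right
  have hsupp : ∀ m : Measure S, ∫⁻ q, f q ∂m = ∫⁻ q in B.domain, f q ∂m := by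
    intro m
    rw [← lintegral_indicator B.isOpen_domain.measurableSet]
    refine lintegral_congr fun q => ?_
    by_cases hq : q ∈ B.domain
    · rw [indicator_of_mem hq]
    · rw [indicator_of_notMem hq]
      exact not_not.1 fun h => hq (hfB q h)
  rw [hsupp, hres, ← hsupp, B.lintegral_boxMeasure g hr ν hf]

end FlowBox

end Disintegration

/-! ### Local product structure of the intersection of two flow-boxes -/

section Overlap

variable {k l : ℕ} {r s : WithTop ℕ∞} {W : Type*} [TopologicalSpace W]
  [ChartedSpace (Model k l) W] {S : Set W}

namespace FlowBox

/-- The intersection of two flow-boxes `B` and `C` around one of its points: the map `h` between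
the local transversals, defined by sliding along the plaques, and the open set `U` of leaf
coordinates of `B`, are such that `B.param '' (U ×ˢ h.source)` is contained in both flow-boxes. -/
structure Overlap (B C : FlowBox k l r s S) (g : LeafMetric k l r s W) (U : Set (Disk k))
    (h : OpenPartialHomeomorph B.transversal C.transversal) : Prop where
  isOpen : IsOpen U
  isHolonomy : IsHolonomy k l h
  mem_domain : ∀ z ∈ U ×ˢ h.source, B.param z ∈ C.domain
  height_eq : ∀ z ∈ U ×ˢ h.source, C.height (B.param z) = C.height (h z.2)
  leafIntegral_eq : ∀ f : S → ℝ≥0∞, (∀ q, f q ≠ 0 → q ∈ B.param '' (U ×ˢ h.source)) →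
    ∀ t ∈ h.source, C.leafIntegral g f (h t) = B.leafIntegral g f t

lemma height_homeo_symm (B : FlowBox k l r s S) (q : B.domain) :
    B.height (B.homeo.symm q).2 = B.height q :=
  B.height_point (B.chart_mem (B.mem_domain.1 q.2) q.1.2).2

lemma smul_mem_ball {c : ℝ} (hc : |c| ≤ 1) {x : EuclideanSpace ℝ (Fin k)}
    (hx : x ∈ Metric.ball 0 1) : c • x ∈ Metric.ball (0 : EuclideanSpace ℝ (Fin k)) 1 := by
  rw [mem_ball_zero_iff] at hx ⊢
  rw [norm_smul, Real.norm_eq_abs]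
  exact (mul_le_of_le_one_left (norm_nonneg x) hc).trans_lt hx

variable {B C : FlowBox k l r s S} {g : LeafMetric k l r s W} {U : Set (Disk k)}
  {h : OpenPartialHomeomorph B.transversal C.transversal}

lemma leafIntegral_eq_zero {V : Set B.transversal} {f : S → ℝ≥0∞}
    (hf : ∀ q, f q ≠ 0 → q ∈ B.param '' (U ×ˢ V)) {t : B.transversal}
    (ht : t ∉ V) : B.leafIntegral g f t = 0 := by
  refine (lintegral_congr fun x => ?_).trans lintegral_zero
  by_cases hq : f (B.param (x, t)) = 0
  · rw [hq, zero_mul]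
  · obtain ⟨z, hz, hzq⟩ := hf _ hq
    rw [B.isOpenEmbedding_param.injective hzq] at hz
    exact absurd hz.2 ht

lemma Overlap.isOpen_image (H : Overlap B C g U h) : IsOpen (B.param '' (U ×ˢ h.source)) :=
  B.isOpenEmbedding_param.isOpenMap _ (H.isOpen.prod h.open_source)

lemma Overlap.leafIntegral_eq_zero (H : Overlap B C g U h) {f : S → ℝ≥0∞}
    (hf : ∀ q, f q ≠ 0 → q ∈ B.param '' (U ×ˢ h.source)) {t : C.transversal}
    (ht : t ∉ h.target) : C.leafIntegral g f t = 0 := by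
  refine (lintegral_congr fun x => ?_).trans lintegral_zero
  by_cases hq : f (C.param (x, t)) = 0
  · rw [hq, zero_mul]
  · obtain ⟨z, hz, hzq⟩ := hf _ hq
    have h1 := H.height_eq z hz
    rw [hzq, height, C.chart_param] at h1
    obtain rfl : t = h z.2 := C.height_injective h1
    exact absurd (h.map_source hz.2) ht

variable (B C g)

/-- Around each of its points, the intersection of two flow-boxes is a product. -/
lemma exists_overlap [T2Space W] (hr : 1 ≤ r) {p : S} (hpB : p ∈ B.domain) (hpC : p ∈ C.domain) :
    ∃ U h, Overlap B C g U h ∧ p ∈ B.param '' (U ×ˢ h.source) := by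
  classical
  have hpB' := B.mem_domain.1 hpB
  have hpC' := C.mem_domain.1 hpC
  set x₀ := (B.chart p).1 with hx₀
  have hp : B.chart p ∈ (B.chart.symm.trans C.chart).source := by
    simp only [mfld_simps]
    exact ⟨B.chart.map_source hpB', by rwa [B.chart.left_inv hpB']⟩
  have hx₀b : x₀ ∈ Metric.ball (0 : EuclideanSpace ℝ (Fin k)) 1 := (B.chart_mem hpB' p.2).1
  -- Both leaf coordinates must stay in the unit ball; the chart domains may be larger than the
  -- boxes away from S.
  have hN : {z : Model k l | z.1 ∈ Metric.ball 0 1 ∧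
      (C.chart (B.chart.symm z)).1 ∈ Metric.ball 0 1} ∈ 𝓝 (B.chart p) := by
    refine Filter.inter_mem ?_ ?_
    · exact continuous_fst.continuousAt.eventually_mem (Metric.isOpen_ball.mem_nhds hx₀b)
    · have h1 : ContinuousAt (fun z => (C.chart (B.chart.symm z)).1) (B.chart p) :=
        continuous_fst.continuousAt.comp ((B.chart.symm.trans C.chart).continuousAt hp)
      refine h1.eventually_mem (Metric.isOpen_ball.mem_nhds ?_)
      rw [B.chart.left_inv hpB']
      exact (C.chart_mem hpC' p.2).1
  obtain ⟨δ, hδ, Y, hpY, hY⟩ := B.isFlowBox.exists_transition C.isFlowBox hr hp hN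
  have hx₀δ : x₀ ∈ Metric.ball x₀ δ := Metric.mem_ball_self hδ
  have hYs : ∀ x ∈ Metric.ball x₀ δ, ∀ y ∈ Y.source,
      (x, y) ∈ B.chart.target ∧ B.chart.symm (x, y) ∈ C.chart.source := by
    intro x hx y hy
    have := (hY x hx y hy).2.1
    simpa only [mfld_simps] using this
  have hchart : ∀ x ∈ Metric.ball x₀ δ, ∀ y ∈ Y.source, C.chart (B.chart.symm (x, y)) =
      ((C.chart (B.chart.symm (x, y))).1, Y y) :=
    fun x hx y hy => Prod.ext rfl (hY x hx y hy).2.2.1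
  have hsymm : ∀ x ∈ Metric.ball x₀ δ, ∀ y ∈ Y.source,
      C.chart.symm ((C.chart (B.chart.symm (x, y))).1, Y y) = B.chart.symm (x, y) := by
    intro x hx y hy
    rw [← hchart x hx y hy, C.chart.left_inv (hYs x hx y hy).2]
  -- S meets each box in full plaques, so one point in both boxes decides on both sides whether the
  -- plaque belongs to S.
  have hK : ∀ y ∈ Y.source, y ∈ B.K ↔ Y y ∈ C.K := by
    intro y hy
    constructor
    · intro hyK
      have h1 := (C.chart_mem (hYs _ hx₀δ y hy).2 (B.symm_mem hx₀b hyK)).2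
      rwa [height, (hY _ hx₀δ y hy).2.2.1] at h1
    · intro hyK
      have h1 := C.symm_mem (hY _ hx₀δ y hy).1.2 hyK
      rw [hsymm _ hx₀δ y hy] at h1
      have h2 := (B.chart_mem (B.chart.map_target (hYs _ hx₀δ y hy).1) h1).2
      rwa [height, B.chart.right_inv (hYs _ hx₀δ y hy).1] at h2
  set tB : B.transversal := (B.homeo.symm ⟨p, hpB⟩).2
  set tC : C.transversal := (C.homeo.symm ⟨p, hpC⟩).2
  -- The defaults `tC` and `tB` only make these functions total; they do not occur on `h.source` and
  -- `h.target`.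
  set F : B.transversal → C.transversal := fun t =>
    if hy : Y (B.height t) ∈ C.K then C.point _ hy else tC
  set F' : C.transversal → B.transversal := fun t =>
    if hy : Y.symm (C.height t) ∈ B.K then B.point _ hy else tB
  have hF : ∀ t : B.transversal, B.height t ∈ Y.source → C.height (F t) = Y (B.height t) := by
    intro t ht
    have hy : Y (B.height t) ∈ C.K := (hK _ ht).1 (B.height_mem t)
    simp only [F, dif_pos hy, height_point]
  have hF' : ∀ t : C.transversal, C.height t ∈ Y.target →
      B.height (F' t) = Y.symm (C.height t) := by
    intro t ht
    have hy : Y.symm (C.height t) ∈ B.K :=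
      (hK _ (Y.map_target ht)).2 (by rw [Y.right_inv ht]; exact C.height_mem t)
    simp only [F', dif_pos hy, height_point]
  let h : OpenPartialHomeomorph B.transversal C.transversal :=
    { toFun := F
      invFun := F'
      source := {t | B.height t ∈ Y.source}
      target := {t | C.height t ∈ Y.target}
      map_source' := fun t ht => by
        rw [mem_ofPred_eq, hF t ht]; exact Y.map_source ht
      map_target' := fun t ht => by
        rw [mem_ofPred_eq, hF' t ht]; exact Y.map_target ht
      left_inv' := fun t ht => B.height_injective (by
        have h1 : C.height (F t) ∈ Y.target := by rw [hF t ht]; exact Y.map_source ht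
        simp only
        rw [hF' _ h1, hF t ht, Y.left_inv ht])
      right_inv' := fun t ht => C.height_injective (by
        have h1 : B.height (F' t) ∈ Y.source := by rw [hF' t ht]; exact Y.map_target ht
        simp only
        rw [hF _ h1, hF' t ht, Y.right_inv ht])
      open_source := Y.open_source.preimage B.continuous_height
      open_target := Y.open_target.preimage C.continuous_height
      continuousOn_toFun := by
        rw [C.isInducing_height.continuousOn_iff]
        exact (Y.continuousOn.comp B.continuous_height.continuousOn fun t ht => ht).congr
          fun t ht => hF t ht
      continuousOn_invFun := by
        rw [B.isInducing_height.continuousOn_iff]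
        exact (Y.continuousOn_symm.comp C.continuous_height.continuousOn fun t ht => ht).congr
          fun t ht => hF' t ht }
  have hsrc : ∀ {t}, t ∈ h.source ↔ B.height t ∈ Y.source := Iff.rfl
  have hh : ∀ t ∈ h.source, C.height (h t) = Y (B.height t) := hF
  set U : Set (Disk k) := {x | (x : EuclideanSpace ℝ (Fin k)) ∈ Metric.ball x₀ δ}
  have hheight : ∀ z ∈ U ×ˢ h.source, C.height (B.param z) = C.height (h z.2) := by
    rintro ⟨x, t⟩ ⟨hx, ht⟩
    rw [hh t ht, B.coe_param]
    exact (hY x hx _ ht).2.2.1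
  refine ⟨U, h, ⟨Metric.isOpen_ball.preimage continuous_subtype_val, ?_, ?_, hheight, ?_⟩, ?_⟩
  · intro t₀ ht₀
    -- The path runs in the plaque of B from its transversal to the point over x₀ for τ ≤ 1/2, then
    -- in the plaque of C to the transversal of C. The clamp `min 1` keeps each formula inside its
    -- ball for every τ, since both branches must be continuous on the whole interval.
    have h2 : ∀ τ : unitInterval, |min 1 (2 * (τ : ℝ))| ≤ 1 ∧ |min 1 (2 - 2 * (τ : ℝ))| ≤ 1 := by
      intro τ
      have h0 := τ.2.1
      have h1 := τ.2.2
      constructor <;> rw [abs_of_nonneg (le_min zero_le_one (by linarith))] <;> exact min_le_left _ _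
    have hX : ∀ t ∈ h.source, (C.chart (B.chart.symm (x₀, B.height t))).1 ∈ Metric.ball 0 1 :=
      fun t ht => (hY x₀ hx₀δ _ ht).1.2
    have hmid : ∀ t ∈ h.source, ∀ τ : unitInterval, (τ : ℝ) = 1 / 2 →
        B.chart.symm ((min 1 (2 * (τ : ℝ))) • x₀, B.height t) =
          C.chart.symm ((min 1 (2 - 2 * (τ : ℝ))) •
            (C.chart (B.chart.symm (x₀, B.height t))).1, C.height (h t)) := by
      intro t ht τ hτ
      rw [hτ, hh t ht]
      norm_num [hsymm x₀ hx₀δ _ ht]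
    refine ⟨h.source, h.open_source.mem_nhds ht₀, subset_rfl, fun z =>
      if (z.2 : ℝ) ≤ 1 / 2 then B.chart.symm ((min 1 (2 * (z.2 : ℝ))) • x₀, B.height z.1)
      else C.chart.symm ((min 1 (2 - 2 * (z.2 : ℝ))) •
        (C.chart (B.chart.symm (x₀, B.height z.1))).1, C.height (h z.1)), ?_, ?_⟩
    · rw [continuousOn_iff_continuous_domRestrict]
      have hfst : Continuous fun z : ↥(h.source ×ˢ (univ : Set unitInterval)) => z.1.1 :=
        continuous_fst.comp continuous_subtype_val
      have hsnd : Continuous fun z : ↥(h.source ×ˢ (univ : Set unitInterval)) =>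
          (z.1.2 : ℝ) :=
        continuous_subtype_val.comp (continuous_snd.comp continuous_subtype_val)
      have hBh := B.continuous_height.comp hfst
      refine Continuous.if_le ?_ ?_ hsnd continuous_const ?_
      · refine B.chart.continuousOn_symm.comp_continuous
          (((continuous_const.min (continuous_const.mul hsnd)).smul continuous_const).prodMk hBh)
          fun z => B.mem_target (smul_mem_ball (h2 z.1.2).1 hx₀b) (B.height_mem z.1.1)
      · have h3 : Continuous fun z : ↥(h.source ×ˢ (univ : Set unitInterval)) =>
            B.chart.symm (x₀, B.height z.1.1) :=
          B.chart.continuousOn_symm.comp_continuous (continuous_const.prodMk hBh)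
            fun z => (hYs x₀ hx₀δ _ z.2.1).1
        have h4 := C.chart.continuousOn.comp_continuous h3 fun z => (hYs x₀ hx₀δ _ z.2.1).2
        refine C.chart.continuousOn_symm.comp_continuous
          (((continuous_const.min (continuous_const.sub (continuous_const.mul hsnd))).smul
            h4.fst).prodMk (C.continuous_height.comp
              (h.continuousOn.comp_continuous hfst fun z => z.2.1))) fun z => ?_
        exact C.mem_target (smul_mem_ball (h2 z.1.2).2 (hX _ z.2.1)) (C.height_mem _)
      · rintro ⟨⟨t, τ⟩, ht, _⟩ hτ
        exact hmid t ht τ hτ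
    · intro t ht
      have hc₁ : Continuous fun τ : unitInterval => (min 1 (2 * (τ : ℝ))) • x₀ := by fun_prop
      have hc₂ : Continuous fun τ : unitInterval => (min 1 (2 - 2 * (τ : ℝ))) •
          (C.chart (B.chart.symm (x₀, B.height t))).1 := by fun_prop
      refine ⟨IsLeafPath.ite (B.isFlowBox.isLeafPath hr hc₁ (y := B.height t) fun τ => ?_)
        (C.isFlowBox.isLeafPath hr hc₂
          (y := C.height (h t)) fun τ => ?_) (hmid t ht), ?_, ?_⟩
      · exact B.mem_target (smul_mem_ball (h2 τ).1 hx₀b) (B.height_mem t)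
      · exact C.mem_target (smul_mem_ball (h2 τ).2 (hX t ht)) (C.height_mem _)
      · simp [B.symm_zero_height]
      · norm_num [C.symm_zero_height]
  · rintro ⟨x, t⟩ ⟨hx, ht⟩
    exact C.mem_domain.2 (hYs x hx _ ht).2
  · intro f hf t ht
    have hyt : B.height t ∈ Y.source := ht
    have hball : Metric.ball x₀ δ ⊆ Metric.ball 0 1 := fun x hx => (hY x hx _ hyt).1.1
    set X : EuclideanSpace ℝ (Fin k) → EuclideanSpace ℝ (Fin k) :=
      fun x => (C.chart (B.chart.symm (x, B.height t))).1
    have hXball : X '' Metric.ball x₀ δ ⊆ Metric.ball 0 1 := by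
      rintro _ ⟨x, hx, rfl⟩
      exact (hY x hx _ hyt).1.2
    have hXinj : InjOn X (Metric.ball x₀ δ) := by
      intro x hx x' hx' hxx
      have h1 : B.chart.symm (x, B.height t) = B.chart.symm (x', B.height t) := by
        rw [← hsymm x hx _ hyt, ← hsymm x' hx' _ hyt]
        exact congrArg (fun x => C.chart.symm (x, Y (B.height t))) hxx
      exact congrArg Prod.fst (B.chart.symm.injOn (hYs x hx _ hyt).1 (hYs x' hx' _ hyt).1 h1)
    have hXd : ∀ x ∈ Metric.ball x₀ δ,
        HasFDerivWithinAt X (fderiv ℝ X x) (Metric.ball x₀ δ) x :=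
      fun x hx => (hY x hx _ hyt).2.2.2.hasFDerivAt.hasFDerivWithinAt
    have hXm : MeasurableSet (X '' Metric.ball x₀ δ) :=
      Metric.isOpen_ball.measurableSet.image_of_continuousOn_injOn
        (fun x hx => (hXd x hx).continuousWithinAt) hXinj
    set f' : W → ℝ≥0∞ := Function.extend Subtype.val f 0
    have hf' : ∀ q : S, f' q = f q := fun q => Subtype.val_injective.extend_apply f 0 q
    have hsupp : ∀ {F : EuclideanSpace ℝ (Fin k) → ℝ≥0∞} {a : Set (EuclideanSpace ℝ (Fin k))},
        MeasurableSet a → a ⊆ Metric.ball 0 1 → (∀ x ∈ Metric.ball 0 1, F x ≠ 0 → x ∈ a) →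
        ∫⁻ x in Metric.ball 0 1, F x = ∫⁻ x in a, F x := by
      intro F a ha hab hF
      rw [← lintegral_indicator Metric.isOpen_ball.measurableSet, ← lintegral_indicator ha]
      refine lintegral_congr fun x => ?_
      by_cases hx : x ∈ a
      · rw [indicator_of_mem hx, indicator_of_mem (hab hx)]
      · rw [indicator_of_notMem hx]
        by_cases hx' : x ∈ Metric.ball (0 : EuclideanSpace ℝ (Fin k)) 1
        · rw [indicator_of_mem hx']
          exact not_not.1 fun h => hx (hF x hx' h)
        · rw [indicator_of_notMem hx']
    -- Both integrals are cut down to a set containing the support, an image of X on the side of C.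
    -- The Jacobian produced by X is then absorbed by `LeafMetric.density_eq`.
    rw [leafIntegral_eq_setLIntegral, leafIntegral_eq_setLIntegral, hsupp hXm hXball,
      hsupp Metric.isOpen_ball.measurableSet hball,
      lintegral_image_eq_lintegral_abs_det_fderiv_mul volume Metric.isOpen_ball.measurableSet hXd
        hXinj]
    · refine setLIntegral_congr_fun Metric.isOpen_ball.measurableSet fun x hx => ?_
      have h1 := LeafMetric.density_eq (g := g) B.isFlowBox C.isFlowBox (hY x hx _ hyt).2.1
      rw [hh t ht, hsymm x hx _ hyt, h1, ENNReal.ofReal_mul (abs_nonneg _), hchart x hx _ hyt]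
      ring
    · intro x hx hne
      have h1 : f (B.param (⟨x, hx⟩, t)) ≠ 0 := by
        rw [← hf', B.coe_param]
        exact left_ne_zero_of_mul hne
      obtain ⟨z, hz, hzq⟩ := hf _ h1
      rw [B.isOpenEmbedding_param.injective hzq] at hz
      exact hz.1
    · intro x hx hne
      have h1 : f (C.param (⟨x, hx⟩, h t)) ≠ 0 := by
        rw [← hf', C.coe_param]
        exact left_ne_zero_of_mul hne
      obtain ⟨z, hz, hzq⟩ := hf _ h1
      have h2 := hheight z hz
      rw [hzq, height, C.chart_param] at h2
      have h3 : t = z.2 := h.injOn ht hz.2 (C.height_injective h2)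
      refine ⟨z.1, hz.1, ?_⟩
      change (C.chart (B.chart.symm (z.1, B.height t))).1 = x
      rw [h3, ← B.coe_param z, hzq, C.chart_param]
  · refine ⟨B.homeo.symm ⟨p, hpB⟩, ⟨hx₀δ, ?_⟩, congrArg Subtype.val (B.homeo.apply_symm_apply _)⟩
    rw [hsrc]
    rw [B.height_homeo_symm]
    exact hpY

end FlowBox

end Overlap

/-! ### Locally equal measures, and transport by partial homeomorphisms -/

section Generic

variable {X Y Z : Type*} [TopologicalSpace X] [MeasurableSpace X] [OpensMeasurableSpace X]
  [TopologicalSpace Y] [MeasurableSpace Y] [BorelSpace Y]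
  [TopologicalSpace Z] [MeasurableSpace Z] [BorelSpace Z]

/-- Two measures which agree locally on a set agree on it. -/
lemma measure_eq_of_locally_eq [SecondCountableTopology X] {μ ν : Measure X} {O : Set X}
    (h : ∀ p ∈ O, ∃ N, IsOpen N ∧ p ∈ N ∧ ∀ E, MeasurableSet E → E ⊆ N → μ E = ν E) {E : Set X}
    (hE : MeasurableSet E) (hEO : E ⊆ O) : μ E = ν E := by
  choose! N hN hpN hμν using h
  -- A countable subcover exists by second countability, and equality of restrictions to a countable
  -- union can be checked on each member.
  obtain ⟨c, hc, hcU⟩ := TopologicalSpace.isOpen_iUnion_countable (fun p : O => N p)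
    fun p => hN p p.2
  have hcount : (N '' (Subtype.val '' c)).Countable := (hc.image _).image _
  have hres : μ.restrict (⋃₀ (N '' (Subtype.val '' c))) =
      ν.restrict (⋃₀ (N '' (Subtype.val '' c))) := by
    rw [Measure.restrict_sUnion_congr hcount]
    rintro _ ⟨_, ⟨p, hp, rfl⟩, rfl⟩
    ext A hA
    rw [Measure.restrict_apply hA, Measure.restrict_apply hA]
    exact hμν p p.2 _ (hA.inter (hN p p.2).measurableSet) inter_subset_right
  have hsub : E ⊆ ⋃₀ (N '' (Subtype.val '' c)) := by
    intro p hp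
    have : p ∈ ⋃ i ∈ c, N (i : O) := by
      rw [hcU]
      exact mem_iUnion.2 ⟨⟨p, hEO hp⟩, hpN p (hEO hp)⟩
    obtain ⟨i, hi, hpi⟩ := mem_iUnion₂.1 this
    exact ⟨N i, ⟨i, ⟨i, hi, rfl⟩, rfl⟩, hpi⟩
  have := congrArg (fun m => m E) hres
  simpa only [Measure.restrict_apply hE, inter_eq_left.2 hsub] using this

/-- The partial homeomorphism `h` maps `ν` to `ν'`. -/
def Transports (h : OpenPartialHomeomorph X Y) (ν : Measure X) (ν' : Measure Y) : Prop :=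
  ∀ E, MeasurableSet E → E ⊆ h.target → ν' E = ν (h.source ∩ h ⁻¹' E)

/-- `h` need not be measurable off its source, so measurability is proved in the subtype and then
pushed forward. -/
lemma measurableSet_source_inter_preimage (h : OpenPartialHomeomorph X Y) {E : Set Y}
    (hE : MeasurableSet E) : MeasurableSet (h.source ∩ h ⁻¹' E) := by
  have h1 : Measurable (h.source.domRestrict h) :=
    (continuousOn_iff_continuous_domRestrict.1 h.continuousOn).measurable
  have h2 := MeasurableSet.subtype_image h.open_source.measurableSet (h1 hE)
  convert h2 using 1
  ext x
  simp [and_comm]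

lemma map_restrict_apply (h : OpenPartialHomeomorph X Y) (ν : Measure X) {E : Set Y}
    (hE : MeasurableSet E) : (ν.restrict h.source).map h E = ν (h.source ∩ h ⁻¹' E) := by
  rw [Measure.map_apply_of_aemeasurable
    (h.continuousOn.aemeasurable h.open_source.measurableSet) hE,
    Measure.restrict_apply' h.open_source.measurableSet, inter_comm]

/-- The setwise form composes and localizes easily; the other one is the invariance in
`TransversalMeasure`. -/
lemma transports_iff {h : OpenPartialHomeomorph X Y} {ν : Measure X} {ν' : Measure Y} :
    Transports h ν ν' ↔ (ν.restrict h.source).map h = ν'.restrict h.target := by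
  constructor
  · intro H
    ext E hE
    rw [map_restrict_apply h ν hE, Measure.restrict_apply hE,
      H _ (hE.inter h.open_target.measurableSet) inter_subset_right]
    congr 1
    ext x
    exact ⟨fun hx => ⟨hx.1, hx.2, h.map_source hx.1⟩, fun hx => ⟨hx.1, hx.2.1⟩⟩
  · intro H E hE hEt
    rw [← map_restrict_apply h ν hE, H, Measure.restrict_apply hE, inter_eq_left.2 hEt]

lemma Transports.refl {ν : Measure Y} :
    Transports (OpenPartialHomeomorph.refl Y) ν ν := by
  intro E _ _
  simp

lemma Transports.trans {h : OpenPartialHomeomorph X Y} {h' : OpenPartialHomeomorph Y Z}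
    {ν : Measure X} {ν' : Measure Y} {ν'' : Measure Z} (H : Transports h ν ν')
    (H' : Transports h' ν' ν'') : Transports (h.trans h') ν ν'' := by
  intro E hE hEt
  rw [OpenPartialHomeomorph.trans_target] at hEt
  rw [H' E hE (hEt.trans inter_subset_left),
    H _ (measurableSet_source_inter_preimage h' hE)]
  · congr 1
    ext x
    simp only [mfld_simps, and_assoc]
  · rintro y ⟨hy, hyE⟩
    have := (hEt hyE).2
    rwa [mem_preimage, h'.left_inv hy] at this

lemma Transports.setLIntegral_eq {h : OpenPartialHomeomorph X Y} {ν : Measure X} {ν' : Measure Y}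
    (H : Transports h ν ν') {F : Y → ℝ≥0∞} (hF : Measurable F) :
    ∫⁻ y in h.target, F y ∂ν' = ∫⁻ x in h.source, F (h x) ∂ν := by
  rw [← transports_iff.1 H, lintegral_map' hF.aemeasurable
    (h.continuousOn.aemeasurable h.open_source.measurableSet)]

/-- Where h and h' coincide on an open set O, injectivity on their whole sources makes the preimages
of a subset of `h '' O` equal under both maps. -/
lemma Transports.of_locally [SecondCountableTopology Y] {h : OpenPartialHomeomorph X Y}
    {ν : Measure X} {ν' : Measure Y}
    (H : ∀ p ∈ h.source, ∃ h' : OpenPartialHomeomorph X Y, Transports h' ν ν' ∧ p ∈ h'.source ∧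
      ∀ᶠ q in 𝓝 p, h q = h' q) : Transports h ν ν' := by
  intro E hE hEt
  rw [← map_restrict_apply h ν hE]
  refine measure_eq_of_locally_eq (O := h.target) (fun y hy => ?_) hE hEt
  obtain ⟨h', H', hp, hev⟩ := H _ (h.map_target hy)
  obtain ⟨O, hO, hOo, hpO⟩ := eventually_nhds_iff.1
    (hev.and ((h.open_source.eventually_mem (h.map_target hy)).and
      (h'.open_source.eventually_mem hp)))
  refine ⟨h '' O, h.isOpen_image_of_subset_source hOo fun x hx => (hO x hx).2.1,
    ⟨_, hpO, h.right_inv hy⟩, fun A hA hAO => ?_⟩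
  have hAt : A ⊆ h'.target := by
    intro z hz
    obtain ⟨x, hx, rfl⟩ := hAO hz
    rw [(hO x hx).1]
    exact h'.map_source (hO x hx).2.2
  rw [map_restrict_apply h ν hA, H' A hA hAt]
  congr 1
  ext x
  constructor
  · rintro ⟨hx, hxA⟩
    obtain ⟨x', hx', hxx⟩ := hAO hxA
    rw [(hO x' hx').1] at hxx
    obtain rfl := h'.injOn (hO x' hx').2.2 hx hxx
    exact ⟨(hO _ hx').2.1, by rw [mem_preimage, (hO _ hx').1]; exact hxA⟩
  · rintro ⟨hx, hxA⟩
    obtain ⟨x', hx', hxx⟩ := hAO hxA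
    obtain rfl := h.injOn (hO x' hx').2.1 hx hxx
    exact ⟨(hO _ hx').2.2, by rw [mem_preimage, ← (hO _ hx').1]; exact hxA⟩

end Generic

/-! ### Comparison of measures in overlapping boxes, and recovery of ν from μ -/

section BoxMeasure

variable {k l : ℕ} {r s : WithTop ℕ∞} {W : Type*} [TopologicalSpace W]
  [SecondCountableTopology W] [MeasurableSpace W] [BorelSpace W]
  [ChartedSpace (Model k l) W] {S : Set W} {B C : FlowBox k l r s S} {g : LeafMetric k l r s W}

/-- A transversal measure, on the local transversal of a flow-box. -/
def TransversalMeasure.onBox (τ : TransversalMeasure k l r s S) (B : FlowBox k l r s S) :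
    Measure B.transversal :=
  τ.measure B.localTransversal

namespace FlowBox

/-- The integrals live over `h.source` and `h.target`, and between these h carries one measure to
the other while preserving leaf integrals. -/
lemma Overlap.lintegral_eq (hr : 1 ≤ r) {U : Set (Disk k)}
    {h : OpenPartialHomeomorph B.transversal C.transversal} (H : Overlap B C g U h)
    {ν : Measure B.transversal} {ν' : Measure C.transversal} (hν : Transports h ν ν')
    {f : S → ℝ≥0∞} (hf : Measurable f) (hfN : ∀ q, f q ≠ 0 → q ∈ B.param '' (U ×ˢ h.source)) :
    ∫⁻ t, B.leafIntegral g f t ∂ν = ∫⁻ t, C.leafIntegral g f t ∂ν' := by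
  have h1 : ∫⁻ t, C.leafIntegral g f t ∂ν' = ∫⁻ t in h.target, C.leafIntegral g f t ∂ν' := by
    rw [← lintegral_indicator h.open_target.measurableSet]
    refine lintegral_congr fun t => ?_
    by_cases ht : t ∈ h.target
    · rw [indicator_of_mem ht]
    · rw [indicator_of_notMem ht, H.leafIntegral_eq_zero hfN ht]
  have h2 : ∫⁻ t, B.leafIntegral g f t ∂ν = ∫⁻ t in h.source, B.leafIntegral g f t ∂ν := by
    rw [← lintegral_indicator h.open_source.measurableSet]
    refine lintegral_congr fun t => ?_
    by_cases ht : t ∈ h.source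
    · rw [indicator_of_mem ht]
    · rw [indicator_of_notMem ht, FlowBox.leafIntegral_eq_zero hfN ht]
  rw [h1, h2, hν.setLIntegral_eq (C.measurable_leafIntegral g hr hf)]
  exact setLIntegral_congr_fun h.open_source.measurableSet fun t ht =>
    (H.leafIntegral_eq f hfN t ht).symm

/-- The measures associated to a transversal measure in two flow-boxes agree on their
intersection. -/
lemma boxMeasure_eq [T2Space W] (hr : 1 ≤ r) (τ : TransversalMeasure k l r s S) {A : Set S}
    (hA : MeasurableSet A) (hAB : A ⊆ B.domain) (hAC : A ⊆ C.domain) :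
    B.boxMeasure g (τ.onBox B) A =
      C.boxMeasure g (τ.onBox C) A := by
  refine measure_eq_of_locally_eq (O := B.domain ∩ C.domain) (fun p hp => ?_) hA
    (subset_inter hAB hAC)
  obtain ⟨U, h, H, hpN⟩ := B.exists_overlap C g hr hp.1 hp.2
  refine ⟨_, H.isOpen_image, hpN, fun E hE hEN => ?_⟩
  have hτ : Transports h (τ.onBox B) (τ.onBox C) :=
    transports_iff.2 (τ.invariant B.localTransversal C.localTransversal h H.isHolonomy)
  rw [B.boxMeasure_apply g hr _ hE, C.boxMeasure_apply g hr _ hE]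
  refine H.lintegral_eq hr hτ (measurable_one.indicator hE) fun q hq => hEN ?_
  exact mem_of_indicator_ne_zero hq

variable (B)

lemma measurableEmbedding_param : MeasurableEmbedding B.param :=
  B.isOpenEmbedding_param.measurableEmbedding

variable (g)

/-- The function equal to the inverse of the density on a product in a flow-box, and zero
elsewhere: its leaf integrals do not depend on the metric. -/
def invDensity (A : Set (Disk k × B.transversal)) : S → ℝ≥0∞ :=
  Function.extend B.param (A.indicator fun z => (ENNReal.ofReal (B.rho g z))⁻¹) 0

lemma measurable_invDensity (hr : 1 ≤ r) {A : Set (Disk k × B.transversal)}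
    (hA : MeasurableSet A) : Measurable (B.invDensity g A) :=
  B.measurableEmbedding_param.measurable_extend
    (((B.continuous_rho g hr).measurable.ennreal_ofReal.inv).indicator hA) measurable_zero

variable {g} in
lemma mem_of_invDensity_ne_zero {A : Set (Disk k × B.transversal)} {q : S}
    (hq : B.invDensity g A q ≠ 0) : q ∈ B.param '' A := by
  by_cases hqr : ∃ z, B.param z = q
  · obtain ⟨z, rfl⟩ := hqr
    rw [invDensity, B.isOpenEmbedding_param.injective.extend_apply] at hq
    exact ⟨z, mem_of_indicator_ne_zero hq, rfl⟩
  · exact absurd (Function.extend_apply' _ _ _ hqr) hq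

/-- The density cancels against its inverse, leaving only Lebesgue measure on the disk. -/
lemma leafIntegral_invDensity (U : Set (Disk k)) (hU : MeasurableSet U)
    (E : Set B.transversal) (t : B.transversal) :
    B.leafIntegral g (B.invDensity g (U ×ˢ E)) t = E.indicator (fun _ => volume U) t := by
  have h1 : ∀ x : Disk k, B.invDensity g (U ×ˢ E) (B.param (x, t)) *
      ENNReal.ofReal (B.rho g (x, t)) = (U ×ˢ E).indicator 1 (x, t) := by
    intro x
    rw [invDensity, B.isOpenEmbedding_param.injective.extend_apply]
    by_cases hz : (x, t) ∈ U ×ˢ E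
    · rw [indicator_of_mem hz, indicator_of_mem hz, Pi.one_apply]
      exact ENNReal.inv_mul_cancel (ENNReal.ofReal_pos.2 (B.rho_pos g _)).ne' ENNReal.ofReal_ne_top
    · rw [indicator_of_notMem hz, indicator_of_notMem hz, zero_mul]
  rw [leafIntegral, lintegral_congr h1]
  by_cases ht : t ∈ E
  · rw [indicator_of_mem ht, ← lintegral_indicator_one hU]
    refine lintegral_congr fun x => ?_
    by_cases hx : x ∈ U
    · rw [indicator_of_mem hx, indicator_of_mem (show (x, t) ∈ U ×ˢ E from ⟨hx, ht⟩)]; rfl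
    · rw [indicator_of_notMem hx, indicator_of_notMem fun h => hx h.1]
  · rw [indicator_of_notMem ht]
    refine (lintegral_congr fun x => ?_).trans lintegral_zero
    exact indicator_of_notMem (fun h => ht h.2) _

variable {B g}

/-- This reads ν off from μ as soon as `volume U` is neither 0 nor ∞. -/
lemma Disintegrates.volume_mul (hr : 1 ≤ r) {μ : Measure S} {ν : Measure B.transversal}
    (h : B.Disintegrates g μ ν) {U : Set (Disk k)} (hU : MeasurableSet U) {E : Set B.transversal}
    (hE : MeasurableSet E) : volume U * ν E = ∫⁻ q, B.invDensity g (U ×ˢ E) q ∂μ := by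
  rw [h.lintegral_eq hr (B.measurable_invDensity g hr (hU.prod hE))]
  · simp only [B.leafIntegral_invDensity g U hU, lintegral_indicator_const hE]
  · intro q hq
    obtain ⟨z, -, rfl⟩ := B.mem_of_invDensity_ne_zero hq
    exact B.param_mem z

lemma volume_disk_pos {U : Set (Disk k)} (hU : IsOpen U) (hne : U.Nonempty) :
    volume U ≠ 0 ∧ volume U ≠ ⊤ :=
  ⟨(hU.measure_pos volume hne).ne', measure_ne_top _ _⟩

lemma disk_univ_nonempty : (univ : Set (Disk k)).Nonempty := ⟨⟨0, zero_mem_ball⟩, trivial⟩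

/-- The measure on the local transversal is determined by the disintegration. -/
lemma Disintegrates.unique (hr : 1 ≤ r) {μ : Measure S} {ν ν' : Measure B.transversal}
    (h : B.Disintegrates g μ ν) (h' : B.Disintegrates g μ ν') : ν = ν' := by
  ext E hE
  have h1 := (h.volume_mul hr MeasurableSet.univ hE).trans
    (h'.volume_mul hr MeasurableSet.univ hE).symm
  obtain ⟨h2, h3⟩ := volume_disk_pos isOpen_univ (disk_univ_nonempty (k := k))
  exact (ENNReal.mul_right_inj h2 h3).1 h1

/-- Seen from B or from C, `B.invDensity` on U × h⁻¹(E) has leaf integral `volume U` over h⁻¹(E) or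
E respectively, and 0 elsewhere. Its μ-integral thus equals `volume U` times either measure, and U
nonempty permits division. -/
lemma Overlap.transports (hr : 1 ≤ r) {U : Set (Disk k)}
    {h : OpenPartialHomeomorph B.transversal C.transversal} (H : Overlap B C g U h)
    (hU : U.Nonempty) {μ : Measure S}
    {ν : Measure B.transversal} {ν' : Measure C.transversal} (hν : B.Disintegrates g μ ν)
    (hν' : C.Disintegrates g μ ν') : Transports h ν ν' := by
  intro E hE hEt
  set E' := h.source ∩ h ⁻¹' E
  have hE' : MeasurableSet E' := measurableSet_source_inter_preimage h hE
  have hm := B.measurable_invDensity g hr (H.isOpen.measurableSet.prod hE')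
  have hsupp : ∀ q, B.invDensity g (U ×ˢ E') q ≠ 0 → q ∈ B.param '' (U ×ˢ h.source) :=
    fun q hq => image_mono (prod_mono subset_rfl inter_subset_left)
      (B.mem_of_invDensity_ne_zero hq)
  have h1 := hν.volume_mul hr H.isOpen.measurableSet hE'
  rw [hν'.lintegral_eq hr hm] at h1
  · have h2 : ∀ t, C.leafIntegral g (B.invDensity g (U ×ˢ E')) t =
        E.indicator (fun _ => volume U) t := by
      intro t
      by_cases ht : t ∈ h.target
      · rw [← h.right_inv ht, H.leafIntegral_eq _ hsupp _ (h.map_target ht),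
          B.leafIntegral_invDensity g U H.isOpen.measurableSet, h.right_inv ht]
        by_cases htE : t ∈ E
        · rw [indicator_of_mem htE, indicator_of_mem]
          exact ⟨h.map_target ht, by rwa [mem_preimage, h.right_inv ht]⟩
        · rw [indicator_of_notMem htE, indicator_of_notMem]
          rintro ⟨-, h3⟩
          rw [mem_preimage, h.right_inv ht] at h3
          exact htE h3
      · rw [H.leafIntegral_eq_zero hsupp ht, indicator_of_notMem fun h3 => ht (hEt h3)]
    rw [lintegral_congr h2, lintegral_indicator_const hE] at h1
    obtain ⟨h3, h4⟩ := volume_disk_pos H.isOpen hU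
    exact ((ENNReal.mul_right_inj h3 h4).1 h1).symm
  · intro q hq
    obtain ⟨z, hz, rfl⟩ := hsupp q hq
    exact H.mem_domain z hz

end FlowBox

end BoxMeasure

/-! ### From transversal measures to finite daval measures -/

section ToMeasure

variable {k l : ℕ} {r s : WithTop ℕ∞} {W : Type*} [TopologicalSpace W] [T2Space W]
  [SecondCountableTopology W] [MeasurableSpace W] [BorelSpace W]
  [ChartedSpace (Model k l) W] {S : Set W} {g : LeafMetric k l r s W}

/-- Countably many flow-boxes cover a solenoid. -/
lemma IsSolenoid.exists_seq_flowBox [Nonempty S] (hS : IsSolenoid k l S)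
    (hW : IsFoliatedManifold k l r s W) (hr : 1 ≤ r) :
    ∃ B : ℕ → FlowBox k l r s S, ⋃ n, (B n).domain = univ := by
  choose B hB using hS.exists_flowBox hW hr
  obtain ⟨c, hc, hcU⟩ := TopologicalSpace.isOpen_iUnion_countable (fun p : S => (B p).domain)
    fun p => (B p).isOpen_domain
  have huniv : ⋃ p : S, (B p).domain = univ :=
    eq_univ_of_forall fun p => mem_iUnion.2 ⟨p, hB p⟩
  rw [huniv] at hcU
  have hne : c.Nonempty := by
    obtain ⟨p⟩ := ‹Nonempty S›
    have : p ∈ ⋃ i ∈ c, (B i).domain := hcU ▸ mem_univ p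
    obtain ⟨i, hi, -⟩ := mem_iUnion₂.1 this
    exact ⟨i, hi⟩
  obtain ⟨f, rfl⟩ := hc.exists_eq_range hne
  refine ⟨fun n => B (f n), ?_⟩
  rwa [biUnion_range] at hcU

/-- A measure on a solenoid is determined by its disintegrations in flow-boxes. -/
lemma measure_unique (hS : IsSolenoid k l S) (hW : IsFoliatedManifold k l r s W) (hr : 1 ≤ r)
    {ν : ∀ B : FlowBox k l r s S, Measure B.transversal} {μ μ' : Measure S}
    (h : ∀ B : FlowBox k l r s S, B.Disintegrates g μ (ν B))
    (h' : ∀ B : FlowBox k l r s S, B.Disintegrates g μ' (ν B)) : μ = μ' := by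
  ext A hA
  refine measure_eq_of_locally_eq (O := univ) (fun p _ => ?_) hA (subset_univ A)
  obtain ⟨B, hp⟩ := hS.exists_flowBox hW hr p
  exact ⟨B.domain, B.isOpen_domain, hp, fun E hE hEB =>
    (h B E hE hEB).trans (h' B E hE hEB).symm⟩

/-- The measure on a solenoid defined by a transversal measure and the volume of the leaves. -/
lemma TransversalMeasure.exists_disintegrates (hS : IsSolenoid k l S)
    (hW : IsFoliatedManifold k l r s W) (hr : 1 ≤ r) (τ : TransversalMeasure k l r s S) :
    ∃ μ : Measure S, ∀ B : FlowBox k l r s S, B.Disintegrates g μ (τ.onBox B) := by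
  rcases isEmpty_or_nonempty S with hemp | hne
  · refine ⟨0, fun B => (B.disintegrates_iff hr).2 fun A _ _ => ?_⟩
    rw [eq_empty_of_isEmpty A, measure_empty, measure_empty]
  obtain ⟨B, hB⟩ := hS.exists_seq_flowBox hW hr
  -- Disjoint pieces prevent overlaps from being counted twice; which box measures a piece is
  -- irrelevant by `boxMeasure_eq`.
  set D := disjointed fun n => (B n).domain
  have hDm : ∀ n, MeasurableSet (D n) :=
    MeasurableSet.disjointed fun n => (B n).isOpen_domain.measurableSet
  refine ⟨Measure.sum fun n => ((B n).boxMeasure g (τ.onBox (B n))).restrict (D n),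
    fun C => (C.disintegrates_iff hr).2 fun A hA hAC => ?_⟩
  rw [Measure.sum_apply _ hA]
  have h1 : ∀ n, ((B n).boxMeasure g (τ.onBox (B n))).restrict (D n) A =
      C.boxMeasure g (τ.onBox C) (A ∩ D n) := by
    intro n
    rw [Measure.restrict_apply hA]
    exact FlowBox.boxMeasure_eq hr τ (hA.inter (hDm n))
      (inter_subset_right.trans (disjointed_subset _ n)) (inter_subset_left.trans hAC)
  rw [tsum_congr h1, ← measure_iUnion, ← inter_iUnion, iUnion_disjointed, hB, inter_univ]
  · intro m n hmn
    exact (disjoint_disjointed (fun n => (B n).domain) hmn).mono inter_subset_right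
      inter_subset_right
  · exact fun n => hA.inter (hDm n)

/-- A transversal measure defines a finite measure. -/
lemma TransversalMeasure.isFiniteMeasure (hS : IsSolenoid k l S)
    (hW : IsFoliatedManifold k l r s W) (hr : 1 ≤ r) (τ : TransversalMeasure k l r s S)
    {μ : Measure S} (h : ∀ B : FlowBox k l r s S, B.Disintegrates g μ (τ.onBox B)) :
    IsFiniteMeasure μ := by
  have : CompactSpace S := isCompact_iff_compactSpace.1 hS.isCompact
  -- On a small product neighbourhood the density is less than `rho z + 1` and the transverse factor
  -- has finite measure. Compactness of S upgrades this to finiteness.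
  have hlf : IsLocallyFiniteMeasure μ := by
    refine ⟨fun p => ?_⟩
    obtain ⟨B, hp⟩ := hS.exists_flowBox hW hr p
    obtain ⟨z, rfl⟩ : ∃ z, B.param z = p := by rwa [← B.range_param] at hp
    have hτ : IsLocallyFiniteMeasure (τ.onBox B) := τ.locallyFinite B.localTransversal
    obtain ⟨V, hV, hVfin⟩ := (τ.onBox B).finiteAt_nhds z.2
    have hρ : ∀ᶠ z' in 𝓝 z, B.rho g z' < B.rho g z + 1 :=
      (B.continuous_rho g hr).continuousAt.eventually_lt_const (lt_add_one _)
    obtain ⟨V', hV'V, hV'o, hzV'⟩ := mem_nhds_iff.1 hV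
    rw [← Prod.mk.eta (p := z), nhds_prod_eq] at hρ
    obtain ⟨U, hU, E, hE, hUE⟩ := mem_prod_iff.1 (inter_mem hρ
      (prod_mem_prod univ_mem (hV'o.mem_nhds hzV')))
    obtain ⟨U', hU'U, hU'o, hzU'⟩ := mem_nhds_iff.1 hU
    obtain ⟨E', hE'E, hE'o, hzE'⟩ := mem_nhds_iff.1 hE
    have hsub : ∀ x ∈ U', ∀ t ∈ E', B.rho g (x, t) < B.rho g z + 1 ∧ t ∈ V' := by
      intro x hx t ht
      have h1 := hUE (show (x, t) ∈ U ×ˢ E from ⟨hU'U hx, hE'E ht⟩)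
      exact ⟨h1.1, h1.2.2⟩
    have hNo : IsOpen (B.param '' (U' ×ˢ E')) :=
      B.isOpenEmbedding_param.isOpenMap _ (hU'o.prod hE'o)
    refine ⟨B.param '' (U' ×ˢ E'), hNo.mem_nhds ⟨z, ⟨hzU', hzE'⟩, rfl⟩, ?_⟩
    have hNB : B.param '' (U' ×ˢ E') ⊆ B.domain := by
      rintro _ ⟨z, -, rfl⟩
      exact B.param_mem z
    rw [(B.disintegrates_iff hr).1 (h B) _ hNo.measurableSet hNB,
      B.boxMeasure_apply g hr _ hNo.measurableSet]
    have hle : ∀ t, B.leafIntegral g ((B.param '' (U' ×ˢ E')).indicator 1) t ≤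
        E'.indicator (fun _ => ENNReal.ofReal (B.rho g z + 1) * volume (univ : Set (Disk k))) t := by
      intro t
      by_cases ht : t ∈ E'
      · rw [indicator_of_mem ht, ← lintegral_const]
        refine lintegral_mono fun x => ?_
        by_cases hx : x ∈ U'
        · calc _ ≤ 1 * ENNReal.ofReal (B.rho g (x, t)) := by
                gcongr
                exact indicator_le_self _ _ _
            _ ≤ _ := by
                rw [one_mul]
                exact ENNReal.ofReal_le_ofReal (hsub x hx t ht).1.le
        · rw [indicator_of_notMem, zero_mul]
          · exact zero_le
          · rintro ⟨z', hz', hzz⟩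
            rw [B.isOpenEmbedding_param.injective hzz] at hz'
            exact hx hz'.1
      · rw [FlowBox.leafIntegral_eq_zero (B := B) (U := U') (V := E') (fun q hq =>
          mem_of_indicator_ne_zero hq) ht]
        exact zero_le
    refine (lintegral_mono hle).trans_lt ?_
    rw [lintegral_indicator_const hE'o.measurableSet]
    refine ENNReal.mul_lt_top (ENNReal.mul_lt_top ENNReal.ofReal_lt_top (measure_lt_top _ _)) ?_
    exact (measure_mono fun t ht =>
      hV'V (hsub _ hzU' t ht).2).trans_lt hVfin
  exact CompactSpace.isFiniteMeasure

/-- A transversal measure defines a non-zero measure. -/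
lemma TransversalMeasure.measure_ne_zero (hr : 1 ≤ r) (τ : TransversalMeasure k l r s S)
    {μ : Measure S} (h : ∀ B : FlowBox k l r s S, B.Disintegrates g μ (τ.onBox B)) : μ ≠ 0 := by
  rintro rfl
  obtain ⟨⟨_, B, rfl⟩, hτ⟩ := τ.nontrivial
  -- The zero measure also disintegrates with transverse measure 0, so uniqueness would make τ
  -- vanish on this transversal.
  refine hτ ((h B).unique hr (g := g) ?_)
  exact (B.disintegrates_iff hr).2 fun A hA _ => by
    rw [B.boxMeasure_apply g hr _ hA, lintegral_zero_measure]; rfl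

end ToMeasure

/-! ### From finite daval measures to transversal measures -/

section ToTransversal

variable {k l : ℕ} {r s : WithTop ℕ∞} {W : Type*} [TopologicalSpace W] [T2Space W]
  [SecondCountableTopology W] [MeasurableSpace W] [BorelSpace W]
  [ChartedSpace (Model k l) W] {S : Set W} {g : LeafMetric k l r s W}

/-- The map `q ↦ Γ q`, from a neighbourhood of `p` in the local transversal of `B` to the
flow-box `C`, induces a measure preserving map between the local transversals. -/
def SlidesTo (ν : ∀ B : FlowBox k l r s S, Measure B.transversal) (B : FlowBox k l r s S)
    (p : B.transversal) (Γ : B.transversal → W) (C : FlowBox k l r s S) : Prop :=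
  Γ p ∈ C.chart.source ∧ ∃ h : OpenPartialHomeomorph B.transversal C.transversal,
    Transports h (ν B) (ν C) ∧ p ∈ h.source ∧ ∀ᶠ q in 𝓝 p, C.height (Γ q) = C.height (h q)

variable {ν : ∀ B : FlowBox k l r s S, Measure B.transversal} {μ : Measure S}
  {B C C' : FlowBox k l r s S} {p : B.transversal}

/-- Compose h with the overlap map from C to C' at Γ p. Γ must stay in S near p because overlaps
describe neighbourhoods in S only. -/
lemma SlidesTo.change (hr : 1 ≤ r) (hν : ∀ B : FlowBox k l r s S, B.Disintegrates g μ (ν B))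
    {Γ : B.transversal → W} (hΓ : ContinuousAt Γ p) (hΓS : ∀ᶠ q in 𝓝 p, Γ q ∈ S)
    (H : SlidesTo ν B p Γ C) (hC' : Γ p ∈ C'.chart.source) : SlidesTo ν B p Γ C' := by
  obtain ⟨hC, h, hh, hp, hev⟩ := H
  have hpS : Γ p ∈ S := hΓS.self_of_nhds
  obtain ⟨U, h₂, H₂, z, hz, hzp⟩ := C.exists_overlap C' g hr
    (p := ⟨Γ p, hpS⟩) (C.mem_domain.2 hC) (C'.mem_domain.2 hC')
  have hzp' : (C.param z : W) = Γ p := congrArg Subtype.val hzp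
  have hheight : ∀ z, C.height (C.param z) = C.height z.2 := by
    intro z
    rw [FlowBox.height, C.chart_param]
  refine ⟨hC', h.trans h₂, hh.trans (H₂.transports hr ⟨_, hz.1⟩ (hν C) (hν C')), ?_, ?_⟩
  · rw [OpenPartialHomeomorph.trans_source]
    refine ⟨hp, ?_⟩
    have h1 := hev.self_of_nhds
    rw [← hzp', hheight] at h1
    rw [mem_preimage, ← C.height_injective h1]
    exact hz.2
  · obtain ⟨O, hO, hON⟩ := isOpen_induced_iff.1 H₂.isOpen_image
    have hpO : Γ p ∈ O := by
      have : (⟨Γ p, hpS⟩ : S) ∈ Subtype.val ⁻¹' O := hON ▸ ⟨z, hz, hzp⟩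
      exact this
    filter_upwards [hev, hΓS, hΓ.eventually_mem (hO.mem_nhds hpO)] with q hq hqS hqO
    have hqN : (⟨Γ q, hqS⟩ : S) ∈ C.param '' (U ×ˢ h₂.source) := by
      rw [← hON]
      exact hqO
    obtain ⟨w, hw, hwq⟩ := hqN
    have hwq' : (C.param w : W) = Γ q := congrArg Subtype.val hwq
    rw [← hwq', hheight] at hq
    rw [← hwq', H₂.height_eq w hw, C.height_injective hq]
    rfl

/-- The transverse coordinate is constant on leaf paths contained in a flow-box. -/
lemma FlowBox.height_eq_of_isLeafPath (hW : IsFoliatedManifold k l r s W) (hr : 1 ≤ r)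
    (C : FlowBox k l r s S) {γ : unitInterval → W} (hγ : IsLeafPath k l γ)
    {J : Set unitInterval} (hJ : IsPreconnected J) (hJC : ∀ t ∈ J, γ t ∈ C.chart.source)
    {t t' : unitInterval} (ht : t ∈ J) (ht' : t' ∈ J) : C.height (γ t) = C.height (γ t') :=
  hJ.induction₂ (fun t t' => C.height (γ t) = C.height (γ t'))
    (fun t ht => eventually_nhdsWithin_of_eventually_nhds
      ((hγ.eventually_eq hW C.isFlowBox hr (hJC t ht)).mono fun _ h => h.symm))
    (fun _ _ _ _ _ _ h h' => h.trans h') (fun _ _ _ _ h => h.symm) ht ht'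

variable {V : Set B.transversal} {Γ : B.transversal × unitInterval → W}

/-- If the path of p stays in the chart of C between the two times, so do nearby paths, by
compactness of the interval. Their heights are then constant, and the same h works. -/
lemma SlidesTo.slide (hW : IsFoliatedManifold k l r s W) (hr : 1 ≤ r) (hV : V ∈ 𝓝 p)
    (hΓ : ContinuousOn Γ (V ×ˢ univ)) (hleaf : ∀ q ∈ V, IsLeafPath k l fun t => Γ (q, t))
    {t t' : unitInterval} (hC : ∀ τ ∈ uIcc t t', Γ (p, τ) ∈ C.chart.source)
    (H : SlidesTo ν B p (fun q => Γ (q, t)) C) : SlidesTo ν B p (fun q => Γ (q, t')) C := by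
  obtain ⟨-, h, hh, hp, hev⟩ := H
  refine ⟨hC t' right_mem_uIcc, h, hh, hp, ?_⟩
  have htube : ∀ᶠ q in 𝓝 p, ∀ τ ∈ uIcc t t', Γ (q, τ) ∈ C.chart.source := by
    refine isCompact_uIcc.eventually_forall_of_forall_eventually fun τ hτ => ?_
    have hcont : ContinuousAt Γ (p, τ) :=
      hΓ.continuousAt (prod_mem_nhds hV univ_mem)
    exact hcont.eventually_mem (C.chart.open_source.mem_nhds (hC τ hτ))
  filter_upwards [hev, htube, hV] with q hq hqt hqV
  rw [← hq]
  exact C.height_eq_of_isLeafPath hW hr (hleaf q hqV) isPreconnected_uIcc hqt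
    right_mem_uIcc left_mem_uIcc

/-- The measures defined on local transversals by a daval measure are invariant by holonomy. -/
lemma transports_of_isHolonomy (hS : IsSolenoid k l S) (hW : IsFoliatedManifold k l r s W)
    (hr : 1 ≤ r) (hν : ∀ B : FlowBox k l r s S, B.Disintegrates g μ (ν B))
    {h : OpenPartialHomeomorph B.transversal C.transversal} (hh : IsHolonomy k l h) :
    Transports h (ν B) (ν C) := by
  refine Transports.of_locally fun p hp => ?_
  obtain ⟨V, hV, hVs, Γ, hΓ, hleaf⟩ := hh p hp
  have hpV : p ∈ V := mem_of_mem_nhds hV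
  -- An initial segment of the leaf path, rescaled to the unit interval, joins q to Γ (q, t), so the
  -- latter is in the leaf of q.
  have hΓS : ∀ q ∈ V, ∀ t, Γ (q, t) ∈ S := by
    intro q hq t
    refine hS.leaf_subset q (B.transversal_spec q).2.1
      ⟨fun τ => Γ (q, τ * t), ⟨(hleaf q hq).1.1.comp (by fun_prop), fun e he τ hτ => ?_⟩, ?_, ?_⟩
    · have h1 := (hleaf q hq).1.2 e he (τ * t) hτ
      have h2 : ContinuousAt (fun τ : unitInterval => τ * t) τ := by fun_prop
      exact h2.eventually h1
    · simp [(hleaf q hq).2.1]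
    · simp
  have hcont : ∀ t, ContinuousAt (fun q => Γ (q, t)) p := by
    intro t
    have h1 : ContinuousAt Γ (p, t) := hΓ.continuousAt (prod_mem_nhds hV univ_mem)
    exact h1.comp (f := fun q => (q, t)) (Continuous.prodMk_left t).continuousAt
  have hevS : ∀ t, ∀ᶠ q in 𝓝 p, Γ (q, t) ∈ S := fun t => mem_of_superset hV fun q hq => hΓS q hq t
  have hstart : SlidesTo ν B p (fun q => Γ (q, 0)) B := by
    refine ⟨?_, OpenPartialHomeomorph.refl _, Transports.refl, trivial, ?_⟩
    · change Γ (p, 0) ∈ _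
      rw [(hleaf p hpV).2.1]
      exact (B.transversal_spec p).1
    · filter_upwards [hV] with q hq
      rw [(hleaf q hq).2.1]
      rfl
  -- Near t₀ the path of p stays in one box D, in which sliding works in both time directions. The
  -- property is thus locally constant in time, and connectedness carries it from time 0 to time 1.
  have hlocal : ∀ t₀ : unitInterval, ∀ᶠ t in 𝓝 t₀,
      ((∃ D, SlidesTo ν B p (fun q => Γ (q, t₀)) D) ↔
        ∃ D, SlidesTo ν B p (fun q => Γ (q, t)) D) := by
    intro t₀
    obtain ⟨D, hD⟩ := hS.exists_flowBox hW hr ⟨Γ (p, t₀), hΓS p hpV t₀⟩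
    have hD' : Γ (p, t₀) ∈ D.chart.source := D.mem_domain.1 hD
    have h1 : {t | Γ (p, t) ∈ D.chart.source} ∈ 𝓝 t₀ :=
      (hleaf p hpV).1.1.continuousAt.eventually_mem (D.chart.open_source.mem_nhds hD')
    obtain ⟨a, b, ht₀, hJt, hJ⟩ := exists_Icc_mem_subset_of_mem_nhds h1
    have hJc : OrdConnected (Icc a b) := ordConnected_Icc
    filter_upwards [hJt] with t ht
    constructor
    · rintro ⟨D', H⟩
      exact ⟨D, (H.change hr hν (hcont t₀) (hevS t₀) hD').slide hW hr hV hΓ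
        (fun q hq => (hleaf q hq).1) fun τ hτ => hJ (hJc.uIcc_subset ht₀ ht hτ)⟩
    · rintro ⟨D', H⟩
      exact ⟨D, (H.change hr hν (hcont t) (hevS t) (hJ ht)).slide hW hr hV hΓ
        (fun q hq => (hleaf q hq).1) fun τ hτ => hJ (hJc.uIcc_subset ht ht₀ hτ)⟩
  obtain ⟨D, hD⟩ := (PreconnectedSpace.induction₂' (fun t t' : unitInterval =>
      (∃ D, SlidesTo ν B p (fun q => Γ (q, t)) D) ↔ ∃ D, SlidesTo ν B p (fun q => Γ (q, t')) D)
    (fun t => (hlocal t).mono fun _ h => ⟨h, h.symm⟩) ⟨fun _ _ _ h h' => Iff.trans h h'⟩ 0 1).1 ⟨B, hstart⟩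
  have hend : Γ (p, 1) ∈ C.chart.source := by
    rw [(hleaf p hpV).2.2]
    exact (C.transversal_spec (h p)).1
  -- With C as the final box, the endpoint Γ (q, 1) is `h q` itself, so equality of heights says
  -- that `h` and `h'` have the same germ at p.
  obtain ⟨-, h', hh', hp', hev⟩ := hD.change hr hν (hcont 1) (hevS 1) hend
  refine ⟨h', hh', hp', ?_⟩
  filter_upwards [hev, hV] with q hq hqV
  rw [(hleaf q hqV).2.2] at hq
  exact C.height_injective hq

/-- The measure on the local transversal associated to a finite measure is locally finite. -/
lemma FlowBox.Disintegrates.isLocallyFiniteMeasure (hr : 1 ≤ r) [IsFiniteMeasure μ]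
    {ν : Measure B.transversal} (h : B.Disintegrates g μ ν) : IsLocallyFiniteMeasure ν := by
  refine ⟨fun t => ?_⟩
  set z : Disk k × B.transversal := (⟨0, FlowBox.zero_mem_ball⟩, t)
  -- A lower bound on the density bounds `invDensity`, whose integral against the finite μ controls
  -- the transverse measure of E'.
  have hρ : ∀ᶠ z' in 𝓝 z, B.rho g z / 2 < B.rho g z' :=
    (B.continuous_rho g hr).continuousAt.eventually_const_lt (half_lt_self (B.rho_pos g z))
  rw [nhds_prod_eq] at hρ
  obtain ⟨U, hU, E, hE, hUE⟩ := mem_prod_iff.1 hρ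
  obtain ⟨U', hU'U, hU'o, hzU'⟩ := mem_nhds_iff.1 hU
  obtain ⟨E', hE'E, hE'o, htE'⟩ := mem_nhds_iff.1 hE
  refine ⟨E', hE'o.mem_nhds htE', ?_⟩
  have h1 := h.volume_mul hr hU'o.measurableSet hE'o.measurableSet
  have h2 : ∫⁻ q, B.invDensity g (U' ×ˢ E') q ∂μ < ⊤ := by
    refine (lintegral_mono (g := fun _ => (ENNReal.ofReal (B.rho g z / 2))⁻¹) fun q => ?_).trans_lt
      ?_
    · by_cases hq : B.invDensity g (U' ×ˢ E') q = 0
      · rw [hq]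
        exact zero_le
      · obtain ⟨w, hw, rfl⟩ := B.mem_of_invDensity_ne_zero hq
        rw [FlowBox.invDensity, B.isOpenEmbedding_param.injective.extend_apply,
          indicator_of_mem hw]
        refine ENNReal.inv_le_inv.2 (ENNReal.ofReal_le_ofReal (le_of_lt ?_))
        exact hUE (show w ∈ U ×ˢ E from ⟨hU'U hw.1, hE'E hw.2⟩)
    · rw [lintegral_const]
      refine ENNReal.mul_lt_top (ENNReal.inv_lt_top.2 (ENNReal.ofReal_pos.2 ?_))
        (measure_lt_top _ _)
      exact half_pos (B.rho_pos g z)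
  rw [← h1] at h2
  exact ENNReal.lt_top_of_mul_ne_top_right h2.ne
    (FlowBox.volume_disk_pos hU'o ⟨_, hzU'⟩).1

/-- Constant paths do it. Different flow-boxes may share the same transversal set, and this
identifies the measures they carry. -/
lemma isHolonomy_setCongr {T T' : Set W} (h : T = T') :
    IsHolonomy k l (Homeomorph.setCongr h).toOpenPartialHomeomorph := by
  refine fun p _ => ⟨univ, univ_mem, subset_univ _, fun z => (z.1 : W), ?_, fun q _ => ?_⟩
  · exact (continuous_subtype_val.comp continuous_fst).continuousOn
  · exact ⟨⟨(continuous_const : Continuous fun _ : unitInterval => (q : W)), fun e he t ht => Eventually.of_forall fun _ => rfl⟩, rfl, rfl⟩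

/-- A daval measure comes from a transversal measure. -/
lemma IsDaval.exists_transversalMeasure (hS : IsSolenoid k l S)
    (hW : IsFoliatedManifold k l r s W) (hr : 1 ≤ r) [IsFiniteMeasure μ] (hμ0 : μ ≠ 0)
    (hμ : IsDaval g μ) :
    ∃ τ : TransversalMeasure k l r s S, ∀ B : FlowBox k l r s S,
      B.Disintegrates g μ (τ.onBox B) := by
  choose ν hν using hμ
  -- One measure per set T is needed, whereas ν is indexed by boxes. Testing on Borel sets of W
  -- avoids transport along equalities of subtypes.
  have hex : ∀ T : LocalTransversal k l r s S, ∃ m : Measure T.1, ∀ B : FlowBox k l r s S,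
      B.transversal = T.1 → ∀ E : Set W, MeasurableSet E →
        m (Subtype.val ⁻¹' E) = ν B (Subtype.val ⁻¹' E) := by
    rintro ⟨_, C, rfl⟩
    refine ⟨ν C, fun B hB E hE => ?_⟩
    have h1 := transports_of_isHolonomy hS hW hr hν (isHolonomy_setCongr (k := k) (l := l) hB)
    rw [h1 _ (hE.preimage measurable_subtype_coe) (subset_univ _)]
    congr 1
    ext t
    simp only [mfld_simps]
    exact Iff.rfl
  choose m hm using hex
  have hmν : ∀ B : FlowBox k l r s S, m B.localTransversal = ν B := by
    intro B
    ext E hE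
    obtain ⟨E', hE', rfl⟩ := hE
    exact hm B.localTransversal B rfl E' hE'
  refine ⟨⟨m, ?_, ?_, ?_⟩, fun B => ?_⟩
  · rintro ⟨_, B, rfl⟩
    have := hmν B
    exact this ▸ (hν B).isLocallyFiniteMeasure hr
  · rintro ⟨_, B, rfl⟩ ⟨_, C, rfl⟩ h hh
    have h1 := transports_iff.1 (transports_of_isHolonomy hS hW hr hν (B := B) (C := C) hh)
    rw [← hmν B, ← hmν C] at h1
    exact h1
  -- If all the transverse measures vanished, μ and 0 would have the same disintegrations.
  · by_contra! h0
    refine hμ0 (measure_unique (g := g) (ν := ν) hS hW hr hν fun B => ?_)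
    rw [show ν B = 0 from (hmν B).symm.trans (h0 _)]
    refine (B.disintegrates_iff hr).2 fun A hA _ => ?_
    rw [B.boxMeasure_apply g hr _ hA, lintegral_zero_measure]
    rfl
  · change B.Disintegrates g μ (m B.localTransversal)
    rw [hmν B]
    exact hν B

/-- A transversal measure is determined by the associated measure. -/
lemma TransversalMeasure.unique (hr : 1 ≤ r) {τ τ' : TransversalMeasure k l r s S}
    (h : ∀ B : FlowBox k l r s S, B.Disintegrates g μ (τ.onBox B))
    (h' : ∀ B : FlowBox k l r s S, B.Disintegrates g μ (τ'.onBox B)) : τ = τ' := by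
  ext1
  funext ⟨_, B, rfl⟩
  exact (h B).unique hr (h' B)

end ToTransversal

/-! ### Partial integrals and a bump function on the disk -/

section CompactSupport

/-- The partial integrals of a continuous function with compact support are continuous. -/
lemma continuous_integral_of_hasCompactSupport {X T : Type*} [TopologicalSpace X]
    [SecondCountableTopology X] [MeasurableSpace X] [OpensMeasurableSpace X] [TopologicalSpace T]
    [FirstCountableTopology T] (μ : Measure X) [IsFiniteMeasure μ] {G : X × T → ℝ}
    (hG : Continuous G) (hc : HasCompactSupport G) : Continuous fun t => ∫ x, G (x, t) ∂μ := by
  obtain ⟨M, hM⟩ := hG.bounded_above_of_compact_support hc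
  refine continuous_of_dominated (bound := fun _ => M) (fun t => ?_) (fun t => ?_)
    (integrable_const M) ?_
  · exact (hG.comp (Continuous.prodMk_left t)).aestronglyMeasurable
  · exact Eventually.of_forall fun x => hM (x, t)
  · exact Eventually.of_forall fun x => hG.comp (Continuous.prodMk_right x)

lemma hasCompactSupport_integral {X T : Type*} [TopologicalSpace X] [MeasurableSpace X]
    [TopologicalSpace T] [T2Space T] (μ : Measure X) {G : X × T → ℝ}
    (hc : HasCompactSupport G) : HasCompactSupport fun t => ∫ x, G (x, t) ∂μ := by
  refine HasCompactSupport.intro (hc.isCompact.image continuous_snd) fun t ht => ?_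
  refine (integral_congr_ae (Eventually.of_forall fun x => ?_)).trans (integral_zero _ _)
  by_contra h
  exact ht ⟨(x, t), subset_tsupport G h, rfl⟩

variable {k : ℕ}

/-- A bump function on the open unit ball. -/
def diskBump (x : Disk k) : ℝ≥0 := Real.toNNReal (1 / 2 - ‖(x : EuclideanSpace ℝ (Fin k))‖)

lemma continuous_diskBump : Continuous (diskBump : Disk k → ℝ≥0) :=
  continuous_real_toNNReal.comp
    (continuous_const.sub (continuous_norm.comp continuous_subtype_val))

lemma hasCompactSupport_diskBump : HasCompactSupport (diskBump : Disk k → ℝ≥0) := by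
  refine HasCompactSupport.intro (K := Subtype.val ⁻¹' Metric.closedBall 0 (1 / 2))
    (IsInducing.subtypeVal.isCompact_preimage' (isCompact_closedBall _ _) ?_) fun x hx => ?_
  · rw [Subtype.range_coe]
    exact Metric.closedBall_subset_ball (by norm_num)
  · rw [mem_preimage, mem_closedBall_zero_iff, not_le] at hx
    exact Real.toNNReal_of_nonpos (by linarith)

/-- The bump is positive at the centre and at most 1. Its integral is the constant divided out when
transverse integrals are recovered from μ. -/
lemma lintegral_diskBump :
    ∫⁻ x : Disk k, (diskBump x : ℝ≥0∞) ≠ 0 ∧ ∫⁻ x : Disk k, (diskBump x : ℝ≥0∞) ≠ ⊤ := by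
  have hc : Continuous fun x : Disk k => (diskBump x : ℝ≥0∞) :=
    ENNReal.continuous_coe.comp continuous_diskBump
  constructor
  · refine ((lintegral_pos_iff_support hc.measurable).2 ?_).ne'
    refine IsOpen.measure_pos volume hc.isOpen_support ⟨⟨0, FlowBox.zero_mem_ball⟩, ?_⟩
    simp [diskBump]
  · refine ((lintegral_mono (g := fun _ => (1 : ℝ≥0∞)) fun x => ?_).trans_lt ?_).ne
    · change (diskBump x : ℝ≥0∞) ≤ 1
      have : diskBump x ≤ 1 := by
        rw [diskBump, Real.toNNReal_le_iff_le_coe]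
        have := norm_nonneg (x : EuclideanSpace ℝ (Fin k))
        push_cast
        linarith
      exact_mod_cast this
    · rw [lintegral_one]
      exact measure_lt_top _ _

end CompactSupport

/-! ### Comparison of test functions on S and on transversals -/

section Topology

variable {k l : ℕ} {r s : WithTop ℕ∞} {W : Type*} [TopologicalSpace W] [T2Space W]
  [SecondCountableTopology W] [MeasurableSpace W] [BorelSpace W]
  [ChartedSpace (Model k l) W] {S : Set W} {g : LeafMetric k l r s W}

lemma TransversalMeasure.continuous_integral (T : LocalTransversal k l r s S)
    (f : CompactlySupportedContinuousMap T.1 ℝ) :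
    Continuous fun τ : TransversalMeasure k l r s S => ∫ t, f t ∂(τ.measure T) :=
  continuous_iInf_dom (i := T) (continuous_iInf_dom (i := f) continuous_induced_dom)

/-- Integrals of functions supported in a flow-box against a transversal measure and the volume
along leaves depend continuously on the transversal measure. -/
lemma TransversalMeasure.continuous_lintegral_leafIntegral (hr : 1 ≤ r) (B : FlowBox k l r s S)
    {f : S → ℝ≥0} (hf : Continuous f) (hc : HasCompactSupport f) (hfB : tsupport f ⊆ B.domain) :
    Continuous fun τ : TransversalMeasure k l r s S =>
      ∫⁻ t, B.leafIntegral g (fun q => (f q : ℝ≥0∞)) t ∂(τ.onBox B) := by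
  set G : Disk k × B.transversal → ℝ := fun z => (f (B.param z) : ℝ) * B.rho g z
  have hG : Continuous G := (NNReal.continuous_coe.comp
    (hf.comp B.isOpenEmbedding_param.continuous)).mul (B.continuous_rho g hr)
  have hGc : HasCompactSupport G := by
    refine HasCompactSupport.intro (K := B.param ⁻¹' tsupport f) ?_ fun z hz => ?_
    · exact B.isOpenEmbedding_param.isInducing.isCompact_preimage' hc.isCompact
        (B.range_param ▸ hfB)
    · simp only [G, image_eq_zero_of_notMem_tsupport hz, NNReal.coe_zero, zero_mul]
  have hG0 : ∀ z, 0 ≤ G z := fun z => mul_nonneg (NNReal.coe_nonneg _) (B.rho_pos g z).le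
  -- Integrating over the disk yields an admissible test function for the topology on transversal
  -- measures.
  set F : CompactlySupportedContinuousMap B.transversal ℝ :=
    ⟨⟨fun t => ∫ x : Disk k, G (x, t), continuous_integral_of_hasCompactSupport volume hG hGc⟩,
      hasCompactSupport_integral volume hGc⟩
  have hF0 : ∀ t, 0 ≤ F t := fun t => integral_nonneg fun x => hG0 (x, t)
  have hleaf : ∀ t, B.leafIntegral g (fun q => (f q : ℝ≥0∞)) t = ENNReal.ofReal (F t) := by
    intro t
    obtain ⟨M, hM⟩ := hG.bounded_above_of_compact_support hGc
    have hint : Integrable fun x : Disk k => G (x, t) := by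
      refine (integrable_const M).mono'
        (hG.comp (Continuous.prodMk_left t)).aestronglyMeasurable
        (Eventually.of_forall fun x => hM (x, t))
    change _ = ENNReal.ofReal (∫ x : Disk k, G (x, t))
    rw [ofReal_integral_eq_lintegral_ofReal hint (Eventually.of_forall fun x => hG0 (x, t))]
    refine lintegral_congr fun x => ?_
    simp only [G]
    rw [ENNReal.ofReal_mul (NNReal.coe_nonneg _), ENNReal.ofReal_coe_nnreal]
  have h1 : ∀ τ : TransversalMeasure k l r s S,
      ∫⁻ t, B.leafIntegral g (fun q => (f q : ℝ≥0∞)) t ∂(τ.onBox B) =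
        ENNReal.ofReal (∫ t, F t ∂(τ.onBox B)) := by
    intro τ
    have : IsLocallyFiniteMeasure (τ.onBox B) := τ.locallyFinite B.localTransversal
    have hFi : Integrable (fun t => F t) (τ.onBox B) :=
      (map_continuous F).integrable_of_hasCompactSupport F.hasCompactSupport'
    rw [ofReal_integral_eq_lintegral_ofReal hFi (Eventually.of_forall hF0)]
    exact lintegral_congr hleaf
  simp only [h1]
  exact ENNReal.continuous_ofReal.comp
    (TransversalMeasure.continuous_integral B.localTransversal F)

/-- Integrals against the measure associated to a transversal measure depend continuously on the
transversal measure. -/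
lemma TransversalMeasure.continuous_lintegral (hS : IsSolenoid k l S)
    (hW : IsFoliatedManifold k l r s W) (hr : 1 ≤ r)
    {m : TransversalMeasure k l r s S → Measure S}
    (hm : ∀ (τ : TransversalMeasure k l r s S) (B : FlowBox k l r s S),
      B.Disintegrates g (m τ) (τ.onBox B)) {f : S → ℝ≥0} (hf : Continuous f) :
    Continuous fun τ => ∫⁻ q, f q ∂(m τ) := by
  have : CompactSpace S := isCompact_iff_compactSpace.1 hS.isCompact
  choose B hB using hS.exists_flowBox hW hr
  obtain ⟨c, hc⟩ := isCompact_univ.elim_finite_subcover (fun p : S => (B p).domain)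
    (fun p => (B p).isOpen_domain) fun p _ => mem_iUnion.2 ⟨p, hB p⟩
  -- The index set is finite, so the integral over S becomes a finite sum of integrals supported in
  -- boxes.
  obtain ⟨χ, hχ⟩ := PartitionOfUnity.exists_isSubordinate (s := (univ : Set S)) isClosed_univ
    (fun p : c => (B p).domain) (fun p => (B p).isOpen_domain)
    fun p hp => by
      obtain ⟨i, hi, hpi⟩ := mem_iUnion₂.1 (hc hp)
      exact mem_iUnion.2 ⟨⟨i, hi⟩, hpi⟩
  set φ : c → S → ℝ≥0 := fun i q => f q * Real.toNNReal (χ i q)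
  have hφ : ∀ i, Continuous (φ i) :=
    fun i => hf.mul (continuous_real_toNNReal.comp (χ i).continuous)
  have hφs : ∀ i, tsupport (φ i) ⊆ (B i).domain := by
    intro i
    refine (closure_mono fun q hq => ?_).trans (hχ i)
    intro h0
    exact hq (by simp only [φ, h0, Real.toNNReal_zero, mul_zero])
  have hsum : ∀ q, ∑ i : c, φ i q = f q := by
    intro q
    have h1 := χ.sum_eq_one (mem_univ q)
    rw [finsum_eq_sum_of_fintype] at h1
    rw [← Finset.mul_sum, ← Real.toNNReal_sum_of_nonneg fun i _ => χ.nonneg i q, h1,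
      Real.toNNReal_one, mul_one]
  have h2 : ∀ τ, ∫⁻ q, f q ∂(m τ) =
      ∑ i : c, ∫⁻ t, (B i).leafIntegral g (fun q => (φ i q : ℝ≥0∞)) t ∂(τ.onBox (B i)) := by
    intro τ
    have h3 : ∀ i : c, ∫⁻ q, (φ i q : ℝ≥0∞) ∂(m τ) =
        ∫⁻ t, (B i).leafIntegral g (fun q => (φ i q : ℝ≥0∞)) t ∂(τ.onBox (B i)) := by
      intro i
      refine (hm τ (B i)).lintegral_eq hr (hφ i).measurable.coe_nnreal_ennreal fun q hq =>
        hφs i (subset_tsupport _ ?_)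
      exact fun h0 => hq (by simp [h0])
    simp only [← h3]
    rw [← lintegral_finsetSum _ fun i _ => (hφ i).measurable.coe_nnreal_ennreal]
    refine lintegral_congr fun q => ?_
    rw [← hsum q]
    push_cast
    rfl
  simp only [h2]
  exact continuous_finsetSum _ fun i _ => continuous_lintegral_leafIntegral hr (B i) (hφ i)
    (isClosed_tsupport _).isCompact (hφs i)

/-- Integrals against the measure on a local transversal, expressed as integrals on the
solenoid. -/
lemma FlowBox.exists_continuous_lintegral_eq (hr : 1 ≤ r) (B : FlowBox k l r s S)
    {f : B.transversal → ℝ} (hf : Continuous f) (hc : HasCompactSupport f) :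
    ∃ H : S → ℝ≥0, Continuous H ∧ ∀ (μ : Measure S) (ν : Measure B.transversal),
      B.Disintegrates g μ ν → ∫⁻ q, H q ∂μ =
        (∫⁻ x : Disk k, (diskBump x : ℝ≥0∞)) * ∫⁻ t, ENNReal.ofReal (f t) ∂ν := by
  -- Dividing by the density makes the plaque integrals of K a fixed constant times the positive
  -- part of f. The bump provides compact support, so extension by zero to S is continuous.
  set K : Disk k × B.transversal → ℝ≥0 :=
    fun z => diskBump z.1 * Real.toNNReal (f z.2) * (Real.toNNReal (B.rho g z))⁻¹
  have hρ0 : ∀ z, Real.toNNReal (B.rho g z) ≠ 0 :=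
    fun z => (Real.toNNReal_pos.2 (B.rho_pos g z)).ne'
  have hK : Continuous K :=
    ((continuous_diskBump.comp continuous_fst).mul
      (continuous_real_toNNReal.comp (hf.comp continuous_snd))).mul
      ((continuous_real_toNNReal.comp (B.continuous_rho g hr)).inv₀ hρ0)
  have hKc : HasCompactSupport K := by
    refine HasCompactSupport.intro
      (hasCompactSupport_diskBump.isCompact.prod hc.isCompact) fun z hz => ?_
    rw [mem_prod, not_and_or] at hz
    rcases hz with hz | hz
    · simp only [K, image_eq_zero_of_notMem_tsupport hz, zero_mul]
    · simp only [K, image_eq_zero_of_notMem_tsupport hz, Real.toNNReal_zero, mul_zero, zero_mul]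
  set H : S → ℝ≥0 := Function.extend Subtype.val (K ∘ B.homeo.symm) 0
  have hH : Continuous H :=
    (hKc.comp_homeomorph B.homeo.symm).continuous_extend_zero B.isOpen_domain
      (hK.comp B.homeo.symm.continuous)
  have hHp : ∀ z, H (B.param z) = K z := by
    intro z
    refine (Subtype.val_injective.extend_apply (K ∘ B.homeo.symm) 0 (B.homeo z)).trans ?_
    rw [Function.comp_apply, Homeomorph.symm_apply_apply]
  refine ⟨H, hH, fun μ ν hν => ?_⟩
  rw [hν.lintegral_eq hr hH.measurable.coe_nnreal_ennreal, ← lintegral_const_mul]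
  · refine lintegral_congr fun t => ?_
    rw [leafIntegral, ← lintegral_mul_const]
    · refine lintegral_congr fun x => ?_
      rw [hHp]
      change ((diskBump x * Real.toNNReal (f t) * (Real.toNNReal (B.rho g (x, t)))⁻¹ : ℝ≥0) :
        ℝ≥0∞) * ((Real.toNNReal (B.rho g (x, t)) : ℝ≥0) : ℝ≥0∞) =
          (diskBump x : ℝ≥0∞) * ((Real.toNNReal (f t) : ℝ≥0) : ℝ≥0∞)
      rw [← ENNReal.coe_mul, mul_assoc, inv_mul_cancel₀ (hρ0 _), mul_one, ENNReal.coe_mul]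
    · exact continuous_diskBump.measurable.coe_nnreal_ennreal
  · exact hf.measurable.ennreal_ofReal
  · intro q hq
    by_contra hqB
    refine hq ?_
    have : H q = 0 := Function.extend_apply' _ _ _ fun ⟨z, hz⟩ => hqB (hz ▸ z.2)
    rw [this, ENNReal.coe_zero]

end Topology

/-! ### The bijection, and continuity in both directions -/

section Correspondence

variable {k l : ℕ} {r s : WithTop ℕ∞} {W : Type*} [TopologicalSpace W] [T2Space W]
  [SecondCountableTopology W] [MeasurableSpace W] [BorelSpace W]
  [ChartedSpace (Model k l) W] {S : Set W} {g : LeafMetric k l r s W}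

lemma FlowBox.Disintegrates.smul (hr : 1 ≤ r) {B : FlowBox k l r s S} {μ : Measure S}
    {ν : Measure B.transversal} (h : B.Disintegrates g μ ν) (c : ℝ≥0∞) :
    B.Disintegrates g (c • μ) (c • ν) := by
  refine (B.disintegrates_iff hr).2 fun A hA hAB => ?_
  have h1 := (B.disintegrates_iff hr).1 h A hA hAB
  rw [B.boxMeasure_apply g hr _ hA] at h1 ⊢
  rw [lintegral_smul_measure, ← h1]
  rfl

/-- The correspondence between transversal measures and finite daval measures. -/
def IsAssociated (g : LeafMetric k l r s W) (τ : TransversalMeasure k l r s S) (μ : Measure S) :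
    Prop :=
  ∀ B : FlowBox k l r s S, B.Disintegrates g μ (τ.onBox B)

lemma IsAssociated.isDaval {τ : TransversalMeasure k l r s S} {μ : Measure S}
    (h : IsAssociated g τ μ) : IsDaval g μ := fun B => ⟨_, h B⟩

/-- Transversal measures correspond to non-zero finite daval measures. -/
lemma exists_equiv (hr : 1 ≤ r) (hW : IsFoliatedManifold k l r s W) (hS : IsSolenoid k l S)
    (g : LeafMetric k l r s W) :
    ∃ Φ : TransversalMeasure k l r s S ≃
        {μ : FiniteMeasure S // μ ≠ 0 ∧ IsDaval g (μ : Measure S)},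
      ∀ τ, IsAssociated g τ ((Φ τ).1 : Measure S) := by
  choose m hm using fun τ : TransversalMeasure k l r s S =>
    τ.exists_disintegrates (g := g) hS hW hr
  have hfin : ∀ τ, IsFiniteMeasure (m τ) := fun τ => τ.isFiniteMeasure hS hW hr (hm τ)
  set M : TransversalMeasure k l r s S → FiniteMeasure S := fun τ => ⟨m τ, hfin τ⟩
  have hne : ∀ τ, M τ ≠ 0 := fun τ h0 =>
    τ.measure_ne_zero hr (hm τ) (congrArg (fun μ : FiniteMeasure S => (μ : Measure S)) h0)
  refine ⟨Equiv.ofBijective (fun τ => ⟨M τ, hne τ, IsAssociated.isDaval (hm τ)⟩)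
    ⟨fun τ τ' h => ?_, ?_⟩, hm⟩
  · have h1 : m τ = m τ' := congrArg Subtype.val (congrArg Subtype.val h)
    exact TransversalMeasure.unique hr (hm τ) (h1 ▸ hm τ')
  · rintro ⟨μ, hμ0, hμ⟩
    have hμ0' : (μ : Measure S) ≠ 0 := fun h0 => hμ0 (Subtype.ext h0)
    obtain ⟨τ, hτ⟩ := hμ.exists_transversalMeasure hS hW hr hμ0'
    refine ⟨τ, Subtype.ext (Subtype.ext ?_)⟩
    exact measure_unique (ν := τ.onBox) hS hW hr (hm τ) hτ

/-- The transversal measure depends continuously on the associated daval measure. -/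
lemma continuous_of_isAssociated (hS : IsSolenoid k l S) (hr : 1 ≤ r) {X : Type*}
    [TopologicalSpace X] {μ : X → ProbabilityMeasure S} (hμ : Continuous μ)
    {θ : X → TransversalMeasure k l r s S}
    (hθ : ∀ x, IsAssociated g (θ x) (μ x : Measure S)) : Continuous θ := by
  have : CompactSpace S := isCompact_iff_compactSpace.1 hS.isCompact
  -- `ENNReal.ofReal` sees only the positive part; real test functions are handled below by applying
  -- this to f and to −f.
  have hint : ∀ (B : FlowBox k l r s S) {f : B.transversal → ℝ}, Continuous f →
      HasCompactSupport f →
      Continuous fun x => (∫⁻ t, ENNReal.ofReal (f t) ∂((θ x).onBox B)).toReal := by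
    intro B f hf hfc
    obtain ⟨H, hH, hHμ⟩ := B.exists_continuous_lintegral_eq (g := g) hr hf hfc
    obtain ⟨hc0, hctop⟩ := lintegral_diskBump (k := k)
    have h1 : ∀ x, ∫⁻ t, ENNReal.ofReal (f t) ∂((θ x).onBox B) =
        (∫⁻ x : Disk k, (diskBump x : ℝ≥0∞))⁻¹ * ∫⁻ q, H q ∂(μ x : Measure S) := by
      intro x
      rw [hHμ _ _ (hθ x B), ← mul_assoc, ENNReal.inv_mul_cancel hc0 hctop, one_mul]
    have hlt : ∀ x, ∫⁻ t, ENNReal.ofReal (f t) ∂((θ x).onBox B) ≠ ⊤ := by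
      intro x
      have : IsLocallyFiniteMeasure ((θ x).onBox B) := (θ x).locallyFinite B.localTransversal
      exact (hf.integrable_of_hasCompactSupport hfc).lintegral_lt_top.ne
    have hcont : Continuous fun x => ∫⁻ t, ENNReal.ofReal (f t) ∂((θ x).onBox B) := by
      simp only [h1]
      exact (ENNReal.continuous_const_mul (ENNReal.inv_ne_top.2 hc0)).comp
        ((ProbabilityMeasure.continuous_lintegral_continuousMap
          (⟨H, hH⟩ : ContinuousMap S ℝ≥0)).comp hμ)
    exact ENNReal.continuousOn_toReal.comp_continuous hcont hlt
  refine continuous_iInf_rng.2 fun T => continuous_iInf_rng.2 fun f => continuous_induced_rng.2 ?_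
  obtain ⟨_, B, rfl⟩ := T
  have hf : Continuous fun t => f t := map_continuous f
  have hfc : HasCompactSupport fun t => f t := f.hasCompactSupport'
  have hnc : HasCompactSupport fun t => -f t := by
    refine HasCompactSupport.intro hfc.isCompact fun t ht => ?_
    rw [image_eq_zero_of_notMem_tsupport ht, neg_zero]
  refine ((hint B hf hfc).sub (hint B hf.neg hnc)).congr fun x => ?_
  have : IsLocallyFiniteMeasure ((θ x).onBox B) := (θ x).locallyFinite B.localTransversal
  exact (integral_eq_lintegral_pos_part_sub_lintegral_neg_part
    (hf.integrable_of_hasCompactSupport hfc)).symm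

/-- The normalized measure associated to a transversal measure depends continuously on it. -/
lemma continuous_normalized (hS : IsSolenoid k l S) (hW : IsFoliatedManifold k l r s W)
    (hr : 1 ≤ r) {m : TransversalMeasure k l r s S → Measure S}
    (hm : ∀ τ, IsAssociated g τ (m τ))
    {N : TransversalMeasure k l r s S → ProbabilityMeasure S}
    (hN : ∀ τ, (N τ : Measure S) = (m τ univ)⁻¹ • m τ) : Continuous N := by
  have : CompactSpace S := isCompact_iff_compactSpace.1 hS.isCompact
  have hfin : ∀ τ, IsFiniteMeasure (m τ) := fun τ => τ.isFiniteMeasure hS hW hr (hm τ)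
  have hmass : Continuous fun τ => m τ univ := by
    have h1 := TransversalMeasure.continuous_lintegral hS hW hr hm (f := fun _ => 1)
      continuous_const
    simpa using h1
  refine ProbabilityMeasure.continuous_iff_forall_continuousMap_continuous_lintegral.2 fun f => ?_
  simp only [hN, lintegral_smul_measure, smul_eq_mul]
  have h2 := TransversalMeasure.continuous_lintegral hS hW hr hm (map_continuous f)
  refine continuous_iff_continuousAt.2 fun τ => ?_
  -- Multiplication in ℝ≥0∞ needs 0 · ∞ excluded: the total mass is finite and nonzero.
  refine ENNReal.Tendsto.mul ((continuous_inv.comp hmass).tendsto τ) ?_ (h2.tendsto τ) ?_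
  · exact Or.inl (ENNReal.inv_ne_zero.2 (measure_ne_top _ _))
  · refine Or.inr (ENNReal.inv_ne_top.2 ?_)
    exact Measure.measure_univ_ne_zero.2 (τ.measure_ne_zero hr (hm τ))

/-- Two transversal measures are equivalent if and only if the associated measures are
proportional. -/
lemma scalarSetoid_iff (hS : IsSolenoid k l S) (hW : IsFoliatedManifold k l r s W) (hr : 1 ≤ r)
    {τ τ' : TransversalMeasure k l r s S} {μ μ' : Measure S} (h : IsAssociated g τ μ)
    (h' : IsAssociated g τ' μ') :
    scalarSetoid k l r s S τ τ' ↔ ∃ c : ℝ≥0, 0 < c ∧ μ' = c • μ := by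
  constructor
  · rintro ⟨c, hc, hcτ⟩
    refine ⟨c, hc, measure_unique (ν := τ'.onBox) hS hW hr h' fun B => ?_⟩
    have h1 : τ'.onBox B = (c : ℝ≥0∞) • τ.onBox B := hcτ B.localTransversal
    rw [h1]
    exact (h B).smul hr c
  · rintro ⟨c, hc, rfl⟩
    refine ⟨c, hc, ?_⟩
    rintro ⟨_, B, rfl⟩
    exact (h' B).unique hr ((h B).smul hr c)

end Correspondence

end Solenoid

end

/-! ### Passage to the quotient and the homeomorphism -/

theorem mainTheorem4 (k l : ℕ) (r s : WithTop ℕ∞) (hr : 1 ≤ r)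
    {W : Type*} [TopologicalSpace W] [T2Space W] [SecondCountableTopology W]
    [MeasurableSpace W] [BorelSpace W] [ChartedSpace (Solenoid.Model k l) W]
    (hW : Solenoid.IsFoliatedManifold k l r s W)
    (S : Set W) (hS : Solenoid.IsSolenoid k l S) (g : Solenoid.LeafMetric k l r s W) :
    ∃ Φ : Solenoid.TransversalMeasure k l r s S ≃
        {μ : FiniteMeasure S // μ ≠ 0 ∧ Solenoid.IsDaval g (μ : Measure S)},
      (∀ (τ : Solenoid.TransversalMeasure k l r s S) (B : Solenoid.FlowBox k l r s S),
        B.Disintegrates g ((Φ τ).1 : Measure S) (τ.measure B.localTransversal)) ∧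
      ∃ Ψ : Solenoid.ProjTransversalMeasure k l r s S ≃ₜ
          {μ : ProbabilityMeasure S // Solenoid.IsDaval g (μ : Measure S)},
        ∀ τ : Solenoid.TransversalMeasure k l r s S,
          ((Ψ (Quotient.mk _ τ)).1 : Measure S) =
            (((Φ τ).1 : Measure S) univ)⁻¹ • ((Φ τ).1 : Measure S) := by
  obtain ⟨Φ, hΦ⟩ := Solenoid.exists_equiv hr hW hS g
  refine ⟨Φ, hΦ, ?_⟩
  have hne : ∀ τ, ((Φ τ).1 : Measure S) ≠ 0 := fun τ => τ.measure_ne_zero hr (hΦ τ)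
  have hprob : ∀ τ, IsProbabilityMeasure
      ((((Φ τ).1 : Measure S) univ)⁻¹ • ((Φ τ).1 : Measure S)) := fun τ =>
    have := NeZero.mk (hne τ)
    isProbabilityMeasureSMul
  have hdaval : ∀ τ, Solenoid.IsDaval g
      ((((Φ τ).1 : Measure S) univ)⁻¹ • ((Φ τ).1 : Measure S)) :=
    fun τ B => ⟨_, (hΦ τ B).smul hr _⟩
  set N : Solenoid.TransversalMeasure k l r s S → ProbabilityMeasure S :=
    fun τ => ⟨_, hprob τ⟩
  have hN : Continuous N := Solenoid.continuous_normalized hS hW hr hΦ fun τ => rfl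
  have hNτ : ∀ τ τ', Solenoid.scalarSetoid k l r s S τ τ' →
      (⟨N τ, hdaval τ⟩ : {μ : ProbabilityMeasure S // Solenoid.IsDaval g (μ : Measure S)}) =
        ⟨N τ', hdaval τ'⟩ := by
    intro τ τ' h
    obtain ⟨c, hc, hcμ⟩ := (Solenoid.scalarSetoid_iff hS hW hr (hΦ τ) (hΦ τ')).1 h
    refine Subtype.ext (Subtype.ext ?_)
    change (((Φ τ).1 : Measure S) univ)⁻¹ • ((Φ τ).1 : Measure S) =
      (((Φ τ').1 : Measure S) univ)⁻¹ • ((Φ τ').1 : Measure S)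
    have hc' : (c : ℝ≥0∞) ≠ 0 := by exact_mod_cast hc.ne'
    have hcμ' : ((Φ τ').1 : Measure S) = (c : ℝ≥0∞) • ((Φ τ).1 : Measure S) := hcμ
    rw [hcμ', Measure.smul_apply, smul_eq_mul, smul_smul,
      ENNReal.mul_inv (Or.inl hc') (Or.inl ENNReal.coe_ne_top), mul_right_comm,
      ENNReal.inv_mul_cancel hc' ENNReal.coe_ne_top, one_mul]
  -- A section of the normalization: since its values are actual transversal measures, continuity of
  -- the inverse follows by composing with the quotient map.
  set F : {μ : ProbabilityMeasure S // Solenoid.IsDaval g (μ : Measure S)} →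
      Solenoid.TransversalMeasure k l r s S := fun μ =>
    Φ.symm ⟨μ.1.toFiniteMeasure, μ.1.toFiniteMeasure_nonzero, μ.2⟩
  have hF : ∀ μ, ((Φ (F μ)).1 : Measure S) = (μ.1 : Measure S) := by
    intro μ
    rw [Equiv.apply_symm_apply]
    rfl
  have hFμ : ∀ μ, Solenoid.IsAssociated g (F μ) (μ.1 : Measure S) := fun μ => hF μ ▸ hΦ (F μ)
  have hFc : Continuous F :=
    Solenoid.continuous_of_isAssociated hS hr continuous_subtype_val hFμ
  refine ⟨
    { toFun := Quotient.lift (fun τ => ⟨N τ, hdaval τ⟩) hNτ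
      invFun := fun μ => Quotient.mk _ (F μ)
      left_inv := ?_
      right_inv := fun μ => ?_
      continuous_toFun := (hN.subtype_mk _).quotient_lift hNτ
      continuous_invFun := continuous_quotient_mk'.comp hFc }, fun τ => rfl⟩
  · rintro ⟨τ⟩
    refine Quotient.sound' ?_
    -- The chosen representative differs from τ by the total mass of the measure associated with τ.
    refine (Solenoid.scalarSetoid_iff hS hW hr (hFμ ⟨N τ, hdaval τ⟩) (hΦ τ)).2
      ⟨(((Φ τ).1 : Measure S) univ).toNNReal, ?_, ?_⟩
    · exact ENNReal.toNNReal_pos (Measure.measure_univ_ne_zero.2 (hne τ)) (measure_ne_top _ _)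
    · change _ = (((((Φ τ).1 : Measure S) univ).toNNReal : ℝ≥0) : ℝ≥0∞) •
        ((((Φ τ).1 : Measure S) univ)⁻¹ • ((Φ τ).1 : Measure S))
      rw [ENNReal.coe_toNNReal (measure_ne_top _ _), smul_smul, ENNReal.mul_inv_cancel
        (Measure.measure_univ_ne_zero.2 (hne τ)) (measure_ne_top _ _), one_smul]
  · refine Subtype.ext (Subtype.ext ?_)
    change (((Φ (F μ)).1 : Measure S) univ)⁻¹ • ((Φ (F μ)).1 : Measure S) = (μ.1 : Measure S)
    rw [hF μ, measure_univ, inv_one, one_smul]
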